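/- Let $n>1$ and let $\Omega=\{z\in\mathbb C^n: r(z)<0\}$ be a non-empty bounded domain of finite type $M$, where $r:\mathbb C^n\to\mathbb R$ is smooth and everywhere convex, with (real) gradient satisfying $|\nabla r|=1$ on the boundary $b\Omega$. Here the type of $p\in b\Omega$ is the supremum of the orders of contact at $p$ of $b\Omega$ with germs of non-singular complex analytic sets of positive dimension, and $M$ is the supremum of the types of the boundary points. *Polydiscs.* For $\xi\in\mathbb C^n$, $u\in\mathbb C^n$ and $\varepsilon>0$ put $\tau(\xi,u,\varepsilon)=\sup\{c>0: |r(\xi+\lambda u)-r(\xi)|\le\varepsilon \text{ for all }\lambda\in\mathbb C,\ |\lambda|\le c\}$. An $\varepsilon$-extremal basis at $\xi$ is an orthonormal basis $u_1,\dots,u_n$ of $\mathbb C^n$ such that $u_1=(q_1-\xi)/|q_1-\xi|$ for some point $q_1$ on the line $\xi+\mathbb R\,\nabla r(\xi)$ with $r(q_1)=r(\xi)+\varepsilon$ and, for $k\ge2$, $u_k$ maximizes the distance from $\xi$ to the level set $\{r=r(\xi)+\varepsilon\}$ along the complex line $\xi+\mathbb C u$, among all unit vectors $u$ orthogonal to $u_1,\dots,u_{k-1}$.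 Choose such a basis for every $\xi\in b\Omega$ and $\varepsilon>0$, and let $P_\varepsilon(\xi)=\{\xi+\sum_k\lambda_ku_k: |\lambda_k|\le\tau(\xi,u_k,\varepsilon),\ 1\le k\le n\}$. *Projections.* Let $U$ be a neighborhood of $b\Omega$ such that every $z\in\Omega\cap U$ has a unique nearest point $\Pi(z)$ in $b\Omega$, and $\frac23\le|\nabla r|\le\frac32$ on $U$. Let $V\subseteq U$ be a neighborhood of $b\Omega$, $t_0>0$, and let $\varphi:V\times[0,t_0)\to U$ be the flow $\partial_t\varphi(x,t)=-\frac{\nabla r}{|\nabla r|^2}(\varphi(x,t))$, $\varphi(x,0)=x$. For $z\in\Omega\cap V$, let $\Pi^{flow}(z)$ be the point $p\in b\Omega$ with $\varphi(p,-r(z))=z$ (where $-r(z)<t_0$ and such a $p$ exists). *Tents.* For $\zeta\in b\Omega$ and $\varepsilon>0$ let $$T_\varepsilon(\zeta)=\{z\in\Omega\cap U:\Pi(z)\in P_\varepsilon(\zeta)\cap b\Omega,\ r(z)\in(-\varepsilon,0)\},$$ $$T^{flow}_\varepsilon(\zeta)=\{z\in\Omega\cap V:\Pi^{flow}(z)\in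 P_\varepsilon(\zeta)\cap b\Omega,\ r(z)\in(-\varepsilon,0)\}.$$ *Dyadic grids.* Let $\rho(\zeta,\eta)=\inf\{\varepsilon>0:\zeta\in P_\varepsilon(\eta),\ \eta\in P_\varepsilon(\zeta)\}$ for $\zeta,\eta\in b\Omega$, and $B(\zeta,\varepsilon)=\{\eta\in b\Omega:\rho(\eta,\zeta)<\varepsilon\}$. A dyadic grid is a family $\mathcal D=\bigcup_{k\ge1}\mathcal D_k$ of subsets of $b\Omega$ with centers $c(Q)\in b\Omega$ and constants $\mathfrak C>1$, $0<\delta,\epsilon<1$ such that: (1) $b\Omega=\bigcup_{Q\in\mathcal D_k}Q$ for all $k\ge1$; (2) two cubes that meet are nested; (3) each $Q\in\mathcal D_k$ contains some $Q'\in\mathcal D_{k+1}$ (a child of $Q$); (4) each $Q\in\mathcal D_{k+1}$ lies in exactly one element of $\mathcal D_k$; (5) $\sigma(Q')\ge\epsilon\,\sigma(Q)$ if $Q'$ is a child of $Q$, where $\sigma$ is surface measure; (6) $B(c(Q),\delta^k)\subseteq Q\subseteq B(c(Q),\mathfrak C\delta^k)$ for $Q\in\mathcal D_k$. For $Q\in\mathcal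 D_k$ put $\ell(Q)=\delta^k$ and $$T_d^{proj}(Q)=\{z\in\Omega\cap U:\Pi(z)\in Q,\ r(z)\in(-\ell(Q),0)\},\qquad T_d^{flow}(Q)=\{z\in\Omega\cap V:\Pi^{flow}(z)\in Q,\ r(z)\in(-\ell(Q),0)\}.$$ **Theorem.** There are constants $C_1>1$, depending only on $r$ and $n$, and $\tau_2>0$, depending only on $r$, $n$ and the fixed $U$, $V$, $t_0$ (not on the choice of extremal bases), such that for all $0<\varepsilon<\tau_2$ and all $\zeta\in b\Omega$ $$T^{flow}_\varepsilon(\zeta)\subseteq T_{C_1\varepsilon}(\zeta)\quad\text{and}\quad T_\varepsilon(\zeta)\subseteq T^{flow}_{C_1\varepsilon}(\zeta).$$ Moreover, with the same constants, for every dyadic grid $\mathcal D$ and every $Q\in\mathcal D$ with $\ell(Q)\le\tau_2/\mathfrak C$, $$T_d^{proj}(Q)\subseteq T^{flow}_{\mathfrak CC_1\ell(Q)}(c(Q))\quad\text{and}\quad T_d^{flow}(Q)\subseteq T_{\mathfrak CC_1\ell(Q)}(c(Q)).$$ -/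

import Mathlib

open Set Filter Topology Asymptotics
open scoped ENNReal ContDiff

noncomputable section

namespace FlowTents

/-- Complex Euclidean space of dimension n. -/
abbrev Cn (n : ℕ) := EuclideanSpace ℂ (Fin n)

variable {n : ℕ}

/-- The domain defined by r. -/
def dom (r : Cn n → ℝ) : Set (Cn n) := {z | r z < 0}

/-- The boundary of the domain defined by r. -/
def bd (r : Cn n → ℝ) : Set (Cn n) := frontier (dom r)

/-! ### Finite type -/

/-- The order of contact of the hypersurface r = 0 with the germ at F 0 of the complex manifold
parametrized by F near 0: the supremum of all s such that r (F w) = O(‖w‖ ^ s) as w tends to 0. -/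
def contactOrder (r : Cn n → ℝ) {d : ℕ} (F : Cn d → Cn n) : ℕ∞ :=
  ⨆ (s : ℕ) (_ : (fun w => r (F w)) =O[𝓝 0] (fun w => ‖w‖ ^ s)), (s : ℕ∞)

/-- F parametrizes near 0 a germ at p of a nonsingular complex analytic set of dimension d ≥ 1. -/
def IsNonsingularGerm {d : ℕ} (p : Cn n) (F : Cn d → Cn n) : Prop :=
  0 < d ∧ AnalyticAt ℂ F 0 ∧ F 0 = p ∧ Function.Injective (fderiv ℂ F 0)

/-- The type of p: the supremum of the orders of contact with germs at p of nonsingular complex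
analytic sets (of positive dimension). -/
def pointType (r : Cn n → ℝ) (p : Cn n) : ℕ∞ :=
  ⨆ (d : ℕ) (F : Cn d → Cn n) (_ : IsNonsingularGerm p F), contactOrder r F

/-- The type of the domain: the supremum of the types of the boundary points. -/
def domainType (r : Cn n → ℝ) : ℕ∞ := ⨆ p ∈ bd r, pointType r p

/-- The domain defined by r is a smoothly bounded convex domain of finite type M, and r is a
smooth, everywhere convex defining function, with gradient of length one on the boundary. The
gradient is the real one, for the underlying real Euclidean space of dimension 2n. -/
structure IsConvexFiniteType (r : Cn n → ℝ) (M : ℕ) : Prop where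
  smooth : ContDiff ℝ ∞ r
  convex : ConvexOn ℝ univ r
  nonempty : (dom r).Nonempty
  bounded : Bornology.IsBounded (dom r)
  grad_bd : ∀ z ∈ bd r, ‖gradient r z‖ = 1
  type_eq : domainType r = (M : ℕ∞)

/-! ### Extremal bases and the polydiscs -/

/-- The supremum of the radii c > 0 with |r(ξ + λ v) - r(ξ)| ≤ ε for all complex λ, |λ| ≤ c. -/
def tau (r : Cn n → ℝ) (ξ v : Cn n) (ε : ℝ) : ℝ :=
  sSup {c : ℝ | 0 < c ∧ ∀ l : ℂ, ‖l‖ ≤ c → |r (ξ + l • v) - r ξ| ≤ ε}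

/-- The distance from ξ to the level set r = r(ξ) + ε along the complex line ξ + ℂ v. -/
def lineDist (r : Cn n → ℝ) (ξ v : Cn n) (ε : ℝ) : ℝ :=
  Metric.infDist ξ {z | r z = r ξ + ε ∧ ∃ l : ℂ, z = ξ + l • v}

/-- u is an ε-extremal basis at ξ: it is orthonormal, the first vector points from ξ to a point of
the level set r = r(ξ) + ε on the line through ξ in the direction of the gradient, and every
further vector maximizes the distance to this level set along complex lines, among all unit
vectors that are complex-orthogonal to the preceding ones. -/
structure IsExtremalBasis (r : Cn n → ℝ) (ξ : Cn n) (ε : ℝ) (u : Fin n → Cn n) : Prop where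
  orthonormal : Orthonormal ℂ u
  first : ∀ k : Fin n, k.val = 0 → ∃ q : Cn n, (∃ t : ℝ, q = ξ + t • gradient r ξ) ∧
    r q = r ξ + ε ∧ u k = ‖q - ξ‖⁻¹ • (q - ξ)
  next : ∀ k : Fin n, 0 < k.val → ∀ v : Cn n, ‖v‖ = 1 → (∀ j < k, inner ℂ (u j) v = 0) →
    lineDist r ξ v ε ≤ lineDist r ξ (u k) ε

/-- A choice of extremal bases at all boundary points and all scales. -/
def IsExtremalChoice (r : Cn n → ℝ) (u : Cn n → ℝ → Fin n → Cn n) : Prop :=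
  ∀ ξ ∈ bd r, ∀ ε : ℝ, 0 < ε → IsExtremalBasis r ξ ε (u ξ ε)

/-- The polydisc P_ε(ξ) for the chosen ε-extremal basis at ξ. -/
def polydisc (r : Cn n → ℝ) (u : Cn n → ℝ → Fin n → Cn n) (ξ : Cn n) (ε : ℝ) : Set (Cn n) :=
  {z | ∃ l : Fin n → ℂ, (∀ k, ‖l k‖ ≤ tau r ξ (u ξ ε k) ε) ∧ z = ξ + ∑ k, l k • u ξ ε k}

/-! ### The quasi-metric and dyadic grids on the boundary -/

/-- The infimum of all ε > 0 such that each point lies in the polydisc of size ε at the other. -/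
def rho (r : Cn n → ℝ) (u : Cn n → ℝ → Fin n → Cn n) (ζ η : Cn n) : ℝ≥0∞ :=
  ⨅ (ε : ℝ) (_ : 0 < ε ∧ ζ ∈ polydisc r u η ε ∧ η ∈ polydisc r u ζ ε), ENNReal.ofReal ε

/-- The ball in the boundary for the quasi-metric. -/
def rhoBall (r : Cn n → ℝ) (u : Cn n → ℝ → Fin n → Cn n) (ζ : Cn n) (ε : ℝ) : Set (Cn n) :=
  {η ∈ bd r | rho r u η ζ < ENNReal.ofReal ε}

/-- Surface measure on the boundary, as Hausdorff measure of dimension 2n - 1 (up to a constant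
normalizing factor, which is irrelevant to the doubling-type comparison where it is used). -/
def surfaceMeasure (r : Cn n → ℝ) : MeasureTheory.Measure (Cn n) :=
  (MeasureTheory.Measure.hausdorffMeasure (2 * (n : ℝ) - 1)).restrict (bd r)

/-- The families D k (k ≥ 1) form a dyadic grid of the boundary, with centers c k Q, sidelengths
δ ^ k, and parameters C (outer constant) and ϵ (proportion of a child). -/
structure IsDyadicGrid (r : Cn n → ℝ) (u : Cn n → ℝ → Fin n → Cn n)
    (D : ℕ → Set (Set (Cn n))) (c : ℕ → Set (Cn n) → Cn n) (C δ ϵ : ℝ) : Prop where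
  one_lt_C : 1 < C
  δ_pos : 0 < δ
  δ_lt_one : δ < 1
  ϵ_pos : 0 < ϵ
  ϵ_lt_one : ϵ < 1
  cover : ∀ k, 1 ≤ k → ⋃₀ D k = bd r
  nested : ∀ j k, 1 ≤ j → 1 ≤ k → ∀ Q₁ ∈ D j, ∀ Q₂ ∈ D k, (Q₁ ∩ Q₂).Nonempty →
    Q₁ ⊆ Q₂ ∨ Q₂ ⊆ Q₁
  child : ∀ k, 1 ≤ k → ∀ Q ∈ D k, ∃ Q' ∈ D (k + 1), Q' ⊆ Q
  parent : ∀ k, 1 ≤ k → ∀ Q ∈ D (k + 1), ∃! Q', Q' ∈ D k ∧ Q ⊆ Q'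
  child_measure : ∀ k, 1 ≤ k → ∀ Q ∈ D k, ∀ Q' ∈ D (k + 1), Q' ⊆ Q →
    ENNReal.ofReal ϵ * surfaceMeasure r Q ≤ surfaceMeasure r Q'
  center_mem : ∀ k, 1 ≤ k → ∀ Q ∈ D k, c k Q ∈ bd r
  sandwich : ∀ k, 1 ≤ k → ∀ Q ∈ D k,
    rhoBall r u (c k Q) (δ ^ k) ⊆ Q ∧ Q ⊆ rhoBall r u (c k Q) (C * δ ^ k)

/-! ### The two projections -/

/-- p is a nearest boundary point of z. -/
def IsNearest (r : Cn n → ℝ) (z p : Cn n) : Prop :=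
  p ∈ bd r ∧ dist z p = Metric.infDist z (bd r)

/-- U is a neighborhood of the boundary, so small that the nearest-point projection is well
defined on the part of U inside the domain, and that the gradient has length between 2/3 and 3/2
on U. -/
structure IsAdmissibleNhd (r : Cn n → ℝ) (U : Set (Cn n)) : Prop where
  nhd : U ∈ 𝓝ˢ (bd r)
  proj : ∀ z ∈ dom r ∩ U, ∃! p, IsNearest r z p
  grad : ∀ z ∈ U, 2 / 3 ≤ ‖gradient r z‖ ∧ ‖gradient r z‖ ≤ 3 / 2

/-- φ is the flow of the vector field -∇r/|∇r|², on V for the times in [0, t₀), with values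
in U. -/
structure IsNormalFlow (r : Cn n → ℝ) (U V : Set (Cn n)) (t₀ : ℝ) (φ : Cn n → ℝ → Cn n) :
    Prop where
  nhd : V ∈ 𝓝ˢ (bd r)
  sub : V ⊆ U
  time_pos : 0 < t₀
  init : ∀ x ∈ V, φ x 0 = x
  mem : ∀ x ∈ V, ∀ t ∈ Ico 0 t₀, φ x t ∈ U
  ode : ∀ x ∈ V, ∀ t ∈ Ico 0 t₀,
    HasDerivWithinAt (φ x) (-((‖gradient r (φ x t)‖ ^ 2)⁻¹ • gradient r (φ x t))) (Ico 0 t₀) t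

/-- p is the boundary point from which the flow reaches z at the time -r(z), that is, p is the
projection of z along the flow lines. -/
def IsFlowProj (r : Cn n → ℝ) (t₀ : ℝ) (φ : Cn n → ℝ → Cn n) (z p : Cn n) : Prop :=
  p ∈ bd r ∧ -r z ∈ Ico 0 t₀ ∧ φ p (-r z) = z

/-! ### Tents -/

/-- The projection tent of height s over a subset S of the boundary. -/
def projTent (r : Cn n → ℝ) (U : Set (Cn n)) (S : Set (Cn n)) (s : ℝ) : Set (Cn n) :=
  {z | z ∈ dom r ∩ U ∧ (∃ p ∈ S, IsNearest r z p) ∧ r z ∈ Ioo (-s) 0}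

/-- The flow tent of height s over a subset S of the boundary. -/
def flowTent (r : Cn n → ℝ) (V : Set (Cn n)) (t₀ : ℝ) (φ : Cn n → ℝ → Cn n)
    (S : Set (Cn n)) (s : ℝ) : Set (Cn n) :=
  {z | z ∈ dom r ∩ V ∧ (∃ p ∈ S, IsFlowProj r t₀ φ z p) ∧ r z ∈ Ioo (-s) 0}

/-- The projection tent T_ε(ζ). -/
def projTentAt (r : Cn n → ℝ) (u : Cn n → ℝ → Fin n → Cn n) (U : Set (Cn n))
    (ζ : Cn n) (ε : ℝ) : Set (Cn n) :=
  projTent r U (polydisc r u ζ ε ∩ bd r) ε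

/-- The flow tent T^flow_ε(ζ). -/
def flowTentAt (r : Cn n → ℝ) (u : Cn n → ℝ → Fin n → Cn n) (V : Set (Cn n)) (t₀ : ℝ)
    (φ : Cn n → ℝ → Cn n) (ζ : Cn n) (ε : ℝ) : Set (Cn n) :=
  flowTent r V t₀ φ (polydisc r u ζ ε ∩ bd r) ε

end FlowTents

end

open Set Filter Topology Asymptotics
open scoped ENNReal ContDiff

noncomputable section

namespace FlowTents

variable {n : ℕ}

section

/-! ### The convex bodies of directions along which r grows by at most ε -/

/-! The flow has speed 1/|∇r| ≤ 3/2, so the flow foot q of a point z lies within (3/2)(-r(z)) of z.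
The nearest boundary point p is no farther from z, hence |p - q| ≤ 3(-r(z)) (`norm_sub_proj_le`).
Both tent inclusions thus reduce to engulfing: points within 3ε of P_ε(ζ) lie in P_{C₁ε}(ζ)
(`exists_polydisc_engulfing`). The second one also needs a flow foot for every interior point near
the boundary (`exists_flowProj`), found by flowing back from z up to level 0.

For engulfing, polydiscs are compared with the convex body of directions whose complex unit disc
stays in {r ≤ r(ξ) + ε}. Convexity makes its gauge subadditive, so P_ε(ξ) has bounded gauge, and a
vector of length O(ε) has gauge O(1) because r is locally Lipschitz. Conversely, the extremality of
the basis bounds the gauge of each component of w by that of w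
(`IsExtremalBasis.gaugeLe_component`), so a small multiple of the body lies in P_ε(ξ).

The remaining constant is absorbed by enlarging ε. Finite type forces a nonzero Taylor coefficient
of order at most M on every complex line, bounded below uniformly by compactness. On small discs the
supremum of r - r(ξ) therefore controls the Taylor remainder and, by interpolation, all the
coefficients. Hence doubling the radius multiplies this supremum by at most K
(`exists_disc_doubling`). In gauge terms, ε ↦ Kε halves the gauge, and this is iterated. -/

/-- The (complex) gauge of w with respect to the body of all directions w such that
r (ξ + l w) ≤ r ξ + ε on the unit disc is at most a. -/
def GaugeLe (r : Cn n → ℝ) (ξ : Cn n) (ε : ℝ) (w : Cn n) (a : ℝ) : Prop :=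
  ∀ l : ℂ, ‖l‖ * a ≤ 1 → r (ξ + l • w) ≤ r ξ + ε

variable {r : Cn n → ℝ} {ξ : Cn n} {ε : ℝ} {w : Cn n} {a : ℝ}

lemma convex_comb_le (hconv : ConvexOn ℝ univ r) (x y : Cn n) {s t : ℝ} (hs : 0 ≤ s) (ht : 0 ≤ t)
    (hst : s + t = 1) : r (s • x + t • y) ≤ s * r x + t * r y :=
  hconv.2 (mem_univ x) (mem_univ y) hs ht hst

lemma GaugeLe.mono_right {b : ℝ} (h : GaugeLe r ξ ε w a) (hab : a ≤ b) : GaugeLe r ξ ε w b :=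
  fun l hl => h l ((mul_le_mul_of_nonneg_left hab (norm_nonneg l)).trans hl)

lemma GaugeLe.mono_left {ε' : ℝ} (h : GaugeLe r ξ ε w a) (hε : ε ≤ ε') : GaugeLe r ξ ε' w a :=
  fun l hl => (h l hl).trans (by linarith)

lemma gaugeLe_zero (hε : 0 ≤ ε) : GaugeLe r ξ ε 0 a := fun l _ => by simpa using hε

lemma GaugeLe.smul (h : GaugeLe r ξ ε w a) (c : ℂ) : GaugeLe r ξ ε (c • w) (‖c‖ * a) := by
  intro l hl
  rw [smul_smul]
  exact h _ (by rwa [norm_mul, mul_assoc])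

lemma GaugeLe.of_smul {c : ℂ} (hc : c ≠ 0) (h : GaugeLe r ξ ε (c • w) a) :
    GaugeLe r ξ ε w (‖c‖⁻¹ * a) := by
  simpa [smul_smul, hc] using h.smul c⁻¹

lemma GaugeLe.smul_le (h : GaugeLe r ξ ε w a) {c : ℂ} (hc : ‖c‖ ≤ 1) (ha : 0 ≤ a) :
    GaugeLe r ξ ε (c • w) a :=
  (h.smul c).mono_right (mul_le_of_le_one_left ha hc)

/-- The point ξ + l(w + w') is the convex combination, with weights a/(a+b) and b/(a+b), of points
on the discs along w and w' rescaled by (a+b)/a and (a+b)/b. -/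
lemma GaugeLe.add (hconv : ConvexOn ℝ univ r) {w' : Cn n} {b : ℝ} (ha : 0 < a) (hb : 0 < b)
    (h : GaugeLe r ξ ε w a) (h' : GaugeLe r ξ ε w' b) : GaugeLe r ξ ε (w + w') (a + b) := by
  intro l hl
  have hab : 0 < a + b := by positivity
  have e : ∀ x : ℝ, 0 < x → ‖(((a + b) / x : ℝ) : ℂ) * l‖ * x = ‖l‖ * (a + b) := by
    intro x hx
    rw [norm_mul, Complex.norm_real, Real.norm_of_nonneg (by positivity)]
    field_simp
  have h1 := h ((((a + b) / a : ℝ) : ℂ) * l) (by rwa [e a ha])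
  have h2 := h' ((((a + b) / b : ℝ) : ℂ) * l) (by rwa [e b hb])
  have hc := convex_comb_le hconv (ξ + ((((a + b) / a : ℝ) : ℂ) * l) • w)
    (ξ + ((((a + b) / b : ℝ) : ℂ) * l) • w')
    (s := a / (a + b)) (t := b / (a + b)) (by positivity) (by positivity) (by field_simp)
  have key : (a / (a + b)) • (ξ + ((((a + b) / a : ℝ) : ℂ) * l) • w) +
      (b / (a + b)) • (ξ + ((((a + b) / b : ℝ) : ℂ) * l) • w') = ξ + l • (w + w') := by
    have hac : (a : ℂ) ≠ 0 := by exact_mod_cast ha.ne'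
    have hbc : (b : ℂ) ≠ 0 := by exact_mod_cast hb.ne'
    have habc : (a : ℂ) + b ≠ 0 := by exact_mod_cast hab.ne'
    ext i
    simp only [PiLp.add_apply, PiLp.smul_apply, smul_eq_mul, Complex.real_smul]
    push_cast
    field_simp
    ring
  rw [key] at hc
  refine hc.trans ?_
  calc _ ≤ a / (a + b) * (r ξ + ε) + b / (a + b) * (r ξ + ε) := by gcongr
    _ = r ξ + ε := by field_simp

/-- The extra `+ 1` keeps the bound positive for the empty sum, as `GaugeLe.add` requires. -/
lemma GaugeLe.sum (hconv : ConvexOn ℝ univ r) (hε : 0 ≤ ε) {ι : Type*} (s : Finset ι)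
    (f : ι → Cn n) (ha : 0 < a) (h : ∀ i ∈ s, GaugeLe r ξ ε (f i) a) :
    GaugeLe r ξ ε (∑ i ∈ s, f i) (a * (s.card + 1)) := by
  classical
  induction s using Finset.induction_on with
  | empty => simpa using gaugeLe_zero hε
  | insert i s hi ih =>
    rw [Finset.sum_insert hi, Finset.card_insert_of_notMem hi]
    have := (h i (by simp)).add hconv ha (by positivity)
      (ih fun j hj => h j (Finset.mem_insert_of_mem hj))
    exact this.mono_right (by push_cast; linarith)

lemma two_mul_le_of_convex (hconv : ConvexOn ℝ univ r) (ξ w : Cn n) :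
    2 * r ξ ≤ r (ξ + w) + r (ξ - w) := by
  have h := convex_comb_le hconv (ξ + w) (ξ - w) (s := 1 / 2) (t := 1 / 2)
    (by norm_num) (by norm_num) (by norm_num)
  have e : (1 / 2 : ℝ) • (ξ + w) + (1 / 2 : ℝ) • (ξ - w) = ξ := by
    rw [← smul_add]
    simp [← two_smul ℝ ξ, smul_smul]
  rw [e] at h
  linarith

/-- Midpoint convexity at l and -l turns the one-sided bound in `GaugeLe` into the two-sided bound
in `tau`. -/
lemma GaugeLe.abs_sub_le (hconv : ConvexOn ℝ univ r) (h : GaugeLe r ξ ε w a) {l : ℂ}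
    (hl : ‖l‖ * a ≤ 1) : |r (ξ + l • w) - r ξ| ≤ ε := by
  have h1 := h l hl
  have h2 := h (-l) (by rwa [norm_neg])
  have h3 := two_mul_le_of_convex hconv ξ (l • w)
  rw [neg_smul, ← sub_eq_add_neg] at h2
  rw [abs_le]
  constructor <;> linarith

/-- Along a segment starting at ξ, the increment of a convex function grows at least linearly. -/
lemma convex_increment_le (hconv : ConvexOn ℝ univ r) (ξ w : Cn n) {s : ℝ} (hs : 0 ≤ s)
    (hs1 : s ≤ 1) : r (ξ + s • w) - r ξ ≤ s * (r (ξ + w) - r ξ) := by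
  have h := convex_comb_le hconv ξ (ξ + w) (s := 1 - s) (t := s)
    (by linarith) hs (by ring)
  have e : (1 - s) • ξ + s • (ξ + w) = ξ + s • w := by module
  rw [e] at h
  linarith

/-- Tangent planes lie below the graph of a convex function. -/
lemma convex_grad_le (hconv : ConvexOn ℝ univ r) (hd : DifferentiableAt ℝ r ξ) (w : Cn n) :
    inner ℝ (gradient r ξ) w ≤ r (ξ + w) - r ξ := by
  have h1 : HasFDerivAt r (innerSL ℝ (gradient r ξ)) ξ := hd.hasGradientAt
  have h2 : HasDerivAt (fun t : ℝ => ξ + t • w) w 0 := by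
    simpa using ((hasDerivAt_id (0 : ℝ)).smul_const w).const_add ξ
  have h3 : HasDerivAt (fun t : ℝ => r (ξ + t • w)) (inner ℝ (gradient r ξ) w) 0 := by
    have h1' : HasFDerivAt r (innerSL ℝ (gradient r ξ)) (ξ + (0 : ℝ) • w) := by simpa using h1
    exact h1'.comp_hasDerivAt (0 : ℝ) h2
  have h4 := h3.tendsto_slope_zero_right
  refine le_of_tendsto h4 ?_
  have : Ioc (0 : ℝ) 1 ∈ 𝓝[>] (0 : ℝ) := Ioc_mem_nhdsGT one_pos
  filter_upwards [this] with t ht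
  have := convex_increment_le hconv ξ w ht.1.le ht.2
  simp only [zero_add, zero_smul, add_zero, smul_eq_mul]
  rw [inv_mul_le_iff₀ ht.1]
  exact this

lemma inner_real_eq_re (x y : Cn n) : (inner ℝ x y : ℝ) = (inner ℂ x y : ℂ).re := by
  simp [PiLp.inner_apply, Complex.inner]

/-! ### Distances to the level sets along complex lines -/

/-- A level point at |l| < 1/a would, by at least linear growth along its ray, force an increment
above ε at radius 1/a. Nonemptiness matters because `Metric.infDist` to the empty set is 0. -/
lemma inv_le_lineDist (hconv : ConvexOn ℝ univ r) (hε : 0 < ε) {v : Cn n} (hv : ‖v‖ = 1)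
    (ha : 0 < a) (h : GaugeLe r ξ ε v a) (hne : ∃ l : ℂ, r (ξ + l • v) = r ξ + ε) :
    a⁻¹ ≤ lineDist r ξ v ε := by
  obtain ⟨l₀, hl₀⟩ := hne
  have hne : {z | r z = r ξ + ε ∧ ∃ l : ℂ, z = ξ + l • v}.Nonempty := ⟨_, hl₀, l₀, rfl⟩
  rw [lineDist, Metric.le_infDist hne]
  rintro _ ⟨hz, l, rfl⟩
  rw [dist_self_add_right, norm_smul, hv, mul_one]
  by_contra! hlt
  have hl1 : ‖l‖ * a < 1 := by
    calc ‖l‖ * a < a⁻¹ * a := by gcongr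
      _ = 1 := inv_mul_cancel₀ ha.ne'
  have hl0 : l ≠ 0 := by
    rintro rfl
    simp at hz
    linarith
  have hs : 0 < ‖l‖ * a := mul_pos (norm_pos_iff.2 hl0) ha
  have hsc : ((‖l‖ * a : ℝ) : ℂ) ≠ 0 := by exact_mod_cast hs.ne'
  have h1 := h (l / ((‖l‖ * a : ℝ) : ℂ)) (by
    rw [norm_div, Complex.norm_real, Real.norm_of_nonneg hs.le]
    have := norm_pos_iff.2 hl0
    exact le_of_eq (by field_simp))
  have h2 := convex_increment_le hconv ξ ((l / ((‖l‖ * a : ℝ) : ℂ)) • v) hs.le hl1.le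
  rw [← Complex.coe_smul, smul_smul, mul_div_cancel₀ _ hsc, hz] at h2
  nlinarith

/-- If r exceeded r(ξ) + ε on the disc, the intermediate value theorem would give a level point
strictly closer to ξ than `lineDist`. -/
lemma gaugeLe_of_le_lineDist (hcont : Continuous r) (hε : 0 < ε) {v : Cn n} (hv : ‖v‖ = 1)
    {l : ℂ} (hl : ‖l‖ ≤ lineDist r ξ v ε) : GaugeLe r ξ ε (l • v) 1 := by
  intro m hm
  rw [mul_one] at hm
  by_contra! hlt
  rw [smul_smul] at hlt
  have hc : ContinuousOn (fun s : ℝ => r (ξ + ((s : ℂ) * (m * l)) • v)) (Icc 0 1) := by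
    fun_prop
  have := intermediate_value_Ioo (zero_le_one' ℝ) hc
  obtain ⟨s, hs, hs'⟩ := this (show r ξ + ε ∈ _ by simpa using ⟨hε, hlt⟩)
  have hd : lineDist r ξ v ε ≤ dist ξ (ξ + ((s : ℂ) * (m * l)) • v) :=
    Metric.infDist_le_dist_of_mem ⟨hs', _, rfl⟩
  rw [dist_self_add_right, norm_smul, hv, mul_one, norm_mul, norm_mul, Complex.norm_real,
    Real.norm_of_nonneg hs.1.le] at hd
  have hl0 : 0 < ‖l‖ := by
    rw [norm_pos_iff]
    rintro rfl
    simp at hlt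
    linarith
  have : s * (‖m‖ * ‖l‖) < ‖l‖ := by
    calc s * (‖m‖ * ‖l‖) ≤ s * (1 * ‖l‖) := by gcongr; exact hs.1.le
      _ < 1 * (1 * ‖l‖) := by gcongr; exact hs.2
      _ = ‖l‖ := by ring
  linarith

/-- The bound is 2 rather than 1 so that attainment of the supremum is not needed: some admissible
radius exceeds |l|/2. -/
lemma gaugeLe_of_le_tau {v : Cn n} (hε : 0 ≤ ε) {l : ℂ} (hl : ‖l‖ ≤ tau r ξ v ε) :
    GaugeLe r ξ ε (l • v) 2 := by
  intro m hm
  rcases eq_or_ne l 0 with rfl | hl0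
  · simpa using hε
  have hl0 : 0 < ‖l‖ := norm_pos_iff.2 hl0
  have hne : {c : ℝ | 0 < c ∧ ∀ l : ℂ, ‖l‖ ≤ c → |r (ξ + l • v) - r ξ| ≤ ε}.Nonempty := by
    by_contra! he
    rw [tau, he, Real.sSup_empty] at hl
    linarith
  have hlt : ‖l‖ / 2 < tau r ξ v ε := by linarith
  obtain ⟨c, hc, hc'⟩ := exists_lt_of_lt_csSup hne hlt
  rw [smul_smul]
  have := hc.2 (m * l) (by rw [norm_mul]; nlinarith)
  linarith [(abs_le.1 this).2]

lemma le_tau_of_gaugeLe (hconv : ConvexOn ℝ univ r) {v : Cn n} {l : ℂ}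
    (h : GaugeLe r ξ ε (l • v) 1) (hunb : ∃ l : ℂ, r ξ + ε < r (ξ + l • v)) (hl : l ≠ 0) :
    ‖l‖ ≤ tau r ξ v ε := by
  -- Growth along the line bounds the set of radii; otherwise `sSup` would take its default value 0.
  obtain ⟨m, hm⟩ := hunb
  refine le_csSup ⟨‖m‖, ?_⟩ ⟨norm_pos_iff.2 hl, fun k hk => ?_⟩
  · rintro c ⟨-, hc⟩
    by_contra! hlt
    linarith [(abs_le.1 (hc m hlt.le)).2]
  · have := h.abs_sub_le hconv (l := k / l) (by
      rw [mul_one, norm_div]; exact div_le_one_of_le₀ hk (norm_nonneg _))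
    rwa [smul_smul, div_mul_cancel₀ _ hl] at this

end

section

/-! ### Consequences of boundedness and smoothness -/

variable {r : Cn n → ℝ} {ξ : Cn n} {ε : ℝ} {w : Cn n} {a : ℝ} {M : ℕ}

lemma eq_zero_of_mem_bd (hcont : Continuous r) (hξ : ξ ∈ bd r) : r ξ = 0 :=
  frontier_lt_subset_eq hcont continuous_const hξ

lemma mem_bd_of_mem_closure (hcont : Continuous r) (h0 : r ξ = 0) (hcl : ξ ∈ closure (dom r)) :
    ξ ∈ bd r := by
  have ho : IsOpen (dom r) := isOpen_lt hcont continuous_const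
  rw [bd, ho.frontier_eq]
  exact ⟨hcl, fun h : r ξ < 0 => by linarith⟩

lemma isCompact_closure_dom (hr : IsConvexFiniteType r M) : IsCompact (closure (dom r)) :=
  hr.bounded.isCompact_closure

lemma isCompact_bd (hr : IsConvexFiniteType r M) : IsCompact (bd r) :=
  (isCompact_closure_dom hr).of_isClosed_subset isClosed_frontier frontier_subset_closure

/-- If r ≤ 0 on the whole ray, its midpoints with a point of the domain would be an unbounded set
inside the domain. Once r is positive somewhere on the ray, convexity gives at least linear growth.
-/
lemma exists_lt_along_ray (hr : IsConvexFiniteType r M) (hξ : ξ ∈ bd r) {v : Cn n} (hv : v ≠ 0)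
    (E : ℝ) : ∃ t : ℝ, E < r (ξ + t • v) := by
  have h0 := eq_zero_of_mem_bd hr.smooth.continuous hξ
  obtain ⟨t, ht, hpos⟩ : ∃ t : ℝ, 0 < t ∧ 0 < r (ξ + t • v) := by
    by_contra! hle
    obtain ⟨z, hz⟩ := hr.nonempty
    obtain ⟨R, hR⟩ := hr.bounded.exists_norm_le
    have hmem : ∀ t : ℝ, 0 < t → ‖(1 / 2 : ℝ) • z + (1 / 2 : ℝ) • (ξ + t • v)‖ ≤ R := by
      intro t ht
      apply hR
      have := convex_comb_le hr.convex z (ξ + t • v) (s := 1 / 2) (t := 1 / 2)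
        (by norm_num) (by norm_num) (by norm_num)
      have hz : r z < 0 := hz
      have := hle t ht
      change r _ < 0
      linarith
    have hv' := norm_pos_iff.2 hv
    have hR0 : 0 ≤ R := (norm_nonneg _).trans (hmem 1 one_pos)
    set t : ℝ := (2 * R + ‖z‖ + ‖ξ‖ + 1) / ‖v‖ with ht
    have ht0 : 0 < t := by positivity
    have h1 := hmem t ht0
    have h2 : t • v = (2 : ℝ) • ((1 / 2 : ℝ) • z + (1 / 2 : ℝ) • (ξ + t • v)) - z - ξ := by
      module
    have h3 : ‖t • v‖ ≤ 2 * R + ‖z‖ + ‖ξ‖ := by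
      rw [h2]
      have h4 := norm_sub_le ((2 : ℝ) • ((1 / 2 : ℝ) • z + (1 / 2 : ℝ) • (ξ + t • v))) z
      rw [norm_smul, Real.norm_of_nonneg zero_le_two] at h4
      refine (norm_sub_le _ _).trans ?_
      linarith
    rw [norm_smul, Real.norm_of_nonneg ht0.le, ht, div_mul_cancel₀ _ hv'.ne'] at h3
    linarith
  set m := r (ξ + t • v)
  set s : ℝ := max 1 ((E + 1) / m) with hs
  have hs1 : 1 ≤ s := le_max_left _ _
  refine ⟨s * t, ?_⟩
  have h1 := convex_increment_le hr.convex ξ ((s * t) • v) (s := s⁻¹) (by positivity)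
    (inv_le_one_of_one_le₀ hs1)
  rw [smul_smul, inv_mul_cancel_left₀ (by positivity), h0, sub_zero, sub_zero,
    le_inv_mul_iff₀ (by positivity)] at h1
  have : E + 1 ≤ s * m := by
    rw [← div_le_iff₀ hpos]
    exact le_max_right _ _
  change s * m ≤ _ at h1
  linarith

lemma exists_level_on_line (hr : IsConvexFiniteType r M) (hξ : ξ ∈ bd r) {v : Cn n} (hv : v ≠ 0)
    (hε : 0 ≤ ε) : ∃ l : ℂ, r (ξ + l • v) = r ξ + ε := by
  obtain ⟨t, ht⟩ := exists_lt_along_ray hr hξ hv (r ξ + ε)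
  have hcont := hr.smooth.continuous
  have hc : ContinuousOn (fun s : ℝ => r (ξ + ((s : ℂ) * (t : ℂ)) • v)) (Icc 0 1) := by
    fun_prop
  have ht' : r ξ + ε < r (ξ + (t : ℂ) • v) := by rwa [Complex.coe_smul]
  obtain ⟨s, -, hs⟩ := intermediate_value_Icc (zero_le_one' ℝ) hc
    (show r ξ + ε ∈ _ by simpa using ⟨hε, ht'.le⟩)
  exact ⟨_, hs⟩

lemma exists_growth_bound (hr : IsConvexFiniteType r M) :
    ∃ L : ℝ, 1 ≤ L ∧ ∀ ξ ∈ bd r, ∀ x : Cn n, ‖x‖ ≤ 1 → r (ξ + x) - r ξ ≤ L * ‖x‖ := by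
  obtain ⟨R, hR⟩ := (isCompact_bd hr).isBounded.exists_norm_le
  obtain ⟨K, hK⟩ := hr.smooth.contDiffOn.exists_lipschitzOnWith (by simp)
    (convex_closedBall (0 : Cn n) (R + 1)) (isCompact_closedBall _ _)
  refine ⟨max 1 K, le_max_left _ _, fun ξ hξ x hx => ?_⟩
  have hξR := hR ξ hξ
  have h := hK.dist_le_mul (ξ + x) (by
      rw [mem_closedBall_zero_iff]
      exact (norm_add_le _ _).trans (add_le_add hξR hx)) ξ (by
      rw [mem_closedBall_zero_iff]
      linarith)
  rw [dist_self_add_left, Real.dist_eq] at h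
  calc _ ≤ K * ‖x‖ := (le_abs_self _).trans h
    _ ≤ max 1 K * ‖x‖ := by gcongr; exact le_max_right _ _

lemma gaugeLe_of_norm_le {L : ℝ} (hL : 1 ≤ L)
    (hbound : ∀ x : Cn n, ‖x‖ ≤ 1 → r (ξ + x) - r ξ ≤ L * ‖x‖) (hε : 0 < ε) (hε1 : ε ≤ 1)
    (hw : ‖w‖ ≤ a * ε) : GaugeLe r ξ ε w (a * L) := by
  intro l hl
  have h1 : L * ‖l • w‖ ≤ ε := by
    rw [norm_smul]
    calc L * (‖l‖ * ‖w‖) ≤ L * (‖l‖ * (a * ε)) := by gcongr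
      _ = (‖l‖ * (a * L)) * ε := by ring
      _ ≤ 1 * ε := by gcongr
      _ = ε := one_mul ε
  have h2 := hbound (l • w) (by nlinarith [norm_nonneg (l • w)])
  linarith

/-! ### Polydiscs and convex bodies -/

variable {u : Cn n → ℝ → Fin n → Cn n}

lemma gaugeLe_of_mem_polydisc (hconv : ConvexOn ℝ univ r) (hε : 0 ≤ ε) {z : Cn n}
    (hz : z ∈ polydisc r u ξ ε) : GaugeLe r ξ ε (z - ξ) (2 * (n + 1)) := by
  obtain ⟨l, hl, rfl⟩ := hz
  rw [add_sub_cancel_left]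
  simpa using GaugeLe.sum hconv hε Finset.univ (fun k => l k • u ξ ε k) two_pos
    fun k _ => gaugeLe_of_le_tau hε (hl k)

/-- Multiply w by l with |l| = 1/a, rotated so that the complex inner product becomes positive; the
tangent plane then bounds it by ε. -/
lemma norm_inner_gradient_le (hconv : ConvexOn ℝ univ r) (hd : DifferentiableAt ℝ r ξ)
    (ha : 0 < a) (h : GaugeLe r ξ ε w a) (hε : 0 ≤ ε) :
    ‖(inner ℂ (gradient r ξ) w : ℂ)‖ ≤ a * ε := by
  set I : ℂ := inner ℂ (gradient r ξ) w with hI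
  rcases eq_or_ne I 0 with h0 | h0
  · rw [h0, norm_zero]; positivity
  have hI0 : 0 < ‖I‖ := norm_pos_iff.2 h0
  set l : ℂ := (starRingEnd ℂ) I * ((‖I‖ * a)⁻¹ : ℝ)
  have h1 := h l (by
    rw [norm_mul, RCLike.norm_conj, Complex.norm_real, Real.norm_of_nonneg (by positivity)]
    exact le_of_eq (by field_simp))
  have h2 := convex_grad_le hconv hd (l • w)
  rw [inner_real_eq_re, inner_smul_right, ← hI] at h2
  have h3 : l * I = ((‖I‖ * a⁻¹ : ℝ) : ℂ) := by
    calc l * I = I * (starRingEnd ℂ) I * ((‖I‖ * a)⁻¹ : ℝ) := by simp only [l]; ring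
      _ = _ := by
        rw [Complex.mul_conj']
        norm_cast
        field_simp
  rw [h3, Complex.ofReal_re] at h2
  have : ‖I‖ * a⁻¹ ≤ ε := by linarith
  rwa [← div_eq_mul_inv, div_le_iff₀' ha] at this

lemma IsExtremalBasis.norm_inner_first_le (hr : IsConvexFiniteType r M) (hξ : ξ ∈ bd r)
    (hε : 0 < ε) {b : Fin n → Cn n} (hb : IsExtremalBasis r ξ ε b) {k : Fin n} (hk : k.val = 0)
    (ha : 0 < a) (h : GaugeLe r ξ ε w a) : ‖(inner ℂ (b k) w : ℂ)‖ ≤ a * ε := by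
  obtain ⟨q, ⟨t, rfl⟩, hq, hbk⟩ := hb.first k hk
  have ht : t ≠ 0 := by
    rintro rfl
    simp at hq
    linarith
  rw [add_sub_cancel_left, norm_smul, hr.grad_bd ξ hξ, mul_one, smul_smul,
    ← Complex.coe_smul] at hbk
  rw [hbk, inner_smul_left, norm_mul, RCLike.norm_conj, Complex.norm_real]
  have : ‖‖t‖⁻¹ * t‖ = 1 := by
    rw [norm_mul, norm_inv, norm_norm, inv_mul_cancel₀ (norm_ne_zero_iff.2 ht)]
  rw [this, one_mul]
  exact norm_inner_gradient_le hr.convex (hr.smooth.differentiable (by simp) ξ) ha h hε.le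

lemma Orthonormal.sum_inner_smul {b : Fin n → Cn n} (hb : Orthonormal ℂ b) (w : Cn n) :
    ∑ k, (inner ℂ (b k) w : ℂ) • b k = w := by
  have hspan : ⊤ ≤ Submodule.span ℂ (range b) := by
    rw [hb.linearIndependent.span_eq_top_of_card_eq_finrank' (by simp)]
  have := (OrthonormalBasis.mk hb hspan).sum_repr' w
  simpa using this

/-- The key property of extremal bases: the components of a vector with respect to the basis are
controlled by the gauge of the vector. -/
lemma IsExtremalBasis.gaugeLe_component (hr : IsConvexFiniteType r M) (hξ : ξ ∈ bd r)
    {L : ℝ} (hL : 1 ≤ L) (hbound : ∀ x : Cn n, ‖x‖ ≤ 1 → r (ξ + x) - r ξ ≤ L * ‖x‖)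
    (hε : 0 < ε) (hε1 : ε ≤ 1) {b : Fin n → Cn n} (hb : IsExtremalBasis r ξ ε b) (ha : 0 < a)
    (h : GaugeLe r ξ ε w a) (k : Fin n) :
    GaugeLe r ξ ε ((inner ℂ (b k) w : ℂ) • b k) (a * (1 + L) * 2 ^ k.val) := by
  -- W m is the part of w orthogonal to the first m basis vectors. Its direction competes in the
  -- extremal problem defining b m.
  set W : ℕ → Cn n := fun m => ∑ j with m ≤ j.val, (inner ℂ (b j) w : ℂ) • b j with hW
  have hW0 : W 0 = w := by simpa [hW] using Orthonormal.sum_inner_smul hb.orthonormal w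
  have hWs : ∀ k : Fin n, W k = (inner ℂ (b k) w : ℂ) • b k + W (k + 1) := by
    intro k
    have : (Finset.univ.filter fun j : Fin n => k.val ≤ j.val) =
        insert k (Finset.univ.filter fun j : Fin n => k.val + 1 ≤ j.val) := by
      ext j
      simp only [Finset.mem_filter, Finset.mem_univ, true_and, Finset.mem_insert, Fin.ext_iff]
      omega
    simp only [hW]
    rw [this, Finset.sum_insert (by simp)]
  have hWi : ∀ (k : Fin n) (j : Fin n), (inner ℂ (b j) (W k) : ℂ) =
      if k ≤ j then inner ℂ (b j) w else 0 := by
    intro k j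
    have ho : ∀ i, (inner ℂ (b j) (b i) : ℂ) = if j = i then 1 else 0 :=
      fun i => orthonormal_iff_ite.1 hb.orthonormal j i
    simp only [hW]
    rw [inner_sum]
    simp_rw [inner_smul_right, ho]
    simp only [mul_ite, mul_one, mul_zero]
    rw [Finset.sum_ite_eq]
    simp only [Finset.mem_filter, Finset.mem_univ, true_and, Fin.le_def]
  have step : ∀ k : Fin n, GaugeLe r ξ ε (W k) (a * (1 + L) * 2 ^ k.val) →
      GaugeLe r ξ ε ((inner ℂ (b k) w : ℂ) • b k) (a * (1 + L) * 2 ^ k.val) := by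
    intro k hk
    have hB : 0 < a * (1 + L) * 2 ^ k.val := by positivity
    rcases Nat.eq_zero_or_pos k.val with h0 | hpos
    · have h1 := hb.norm_inner_first_le hr hξ hε h0 ha h
      have h2 : ‖(inner ℂ (b k) w : ℂ) • b k‖ ≤ a * ε := by
        rwa [norm_smul, hb.orthonormal.1 k, mul_one]
      refine (gaugeLe_of_norm_le hL hbound hε hε1 h2).mono_right ?_
      rw [h0]
      nlinarith
    · have hck : (inner ℂ (b k) (W k) : ℂ) = inner ℂ (b k) w := by simp [hWi]
      rcases eq_or_ne (W k) 0 with hz | hz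
      · rw [← hck, hz, inner_zero_right, zero_smul]
        exact gaugeLe_zero hε.le
      have hz' : 0 < ‖W k‖ := norm_pos_iff.2 hz
      set B := a * (1 + L) * 2 ^ k.val
      set v : Cn n := ((‖W k‖⁻¹ : ℝ) : ℂ) • W k with hv
      have hnorm : ‖((‖W k‖⁻¹ : ℝ) : ℂ)‖ = ‖W k‖⁻¹ := by
        rw [Complex.norm_real, Real.norm_of_nonneg (by positivity)]
      have hv1 : ‖v‖ = 1 := by rw [hv, norm_smul, hnorm, inv_mul_cancel₀ hz'.ne']
      have hvo : ∀ j < k, (inner ℂ (b j) v : ℂ) = 0 := by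
        intro j hj
        rw [hv, inner_smul_right, hWi, if_neg (not_le.2 hj), mul_zero]
      have hv0 : v ≠ 0 := by
        rintro h
        simp [h] at hv1
      have hgv : GaugeLe r ξ ε v (‖W k‖⁻¹ * B) := by
        have := hk.smul ((‖W k‖⁻¹ : ℝ) : ℂ)
        rwa [hnorm] at this
      -- Maximality of b k: ‖W k‖ / B ≤ dist along v ≤ dist along b k. The k-th coefficient is at
      -- most ‖W k‖, so the component inherits the gauge bound B.
      have h1 := (inv_le_lineDist hr.convex hε hv1 (by positivity) hgv
        (exists_level_on_line hr hξ hv0 hε.le)).trans (hb.next k hpos v hv1 hvo)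
      have h2 : ‖(inner ℂ (b k) w : ℂ)‖ ≤ ‖W k‖ := by
        rw [← hck]
        simpa [hb.orthonormal.1 k] using norm_inner_le_norm (𝕜 := ℂ) (b k) (W k)
      have hBc : ‖((B⁻¹ : ℝ) : ℂ)‖ = B⁻¹ := by
        rw [Complex.norm_real, Real.norm_of_nonneg (by positivity)]
      have h3 : GaugeLe r ξ ε ((((B⁻¹ : ℝ) : ℂ) * inner ℂ (b k) w) • b k) 1 := by
        refine gaugeLe_of_le_lineDist hr.smooth.continuous hε (hb.orthonormal.1 k) (le_trans ?_ h1)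
        rw [norm_mul, hBc, mul_inv (‖W k‖⁻¹) B, inv_inv, mul_comm]
        gcongr
      rw [mul_smul] at h3
      have h4 := h3.of_smul (by exact_mod_cast (inv_pos.2 hB).ne')
      rwa [hBc, inv_inv, mul_one] at h4
  -- Subtracting a component with the same gauge bound at most doubles the bound, whence the powers
  -- of 2.
  have hind : ∀ m : ℕ, ∀ hm : m < n, GaugeLe r ξ ε (W m) (a * (1 + L) * 2 ^ m) := by
    intro m
    induction m with
    | zero =>
      intro _
      rw [hW0]
      exact h.mono_right (by nlinarith)
    | succ m ih =>
      intro hm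
      have hm' : m < n := by omega
      have h1 := ih hm'
      have h2 := (step ⟨m, hm'⟩ h1).smul_le (c := -1) (by simp) (by positivity)
      have h3 := h1.add hr.convex (by positivity) (by positivity) h2
      have h4 := hWs ⟨m, hm'⟩
      simp only at h4
      have h5 : W (m + 1) = W m + (-1 : ℂ) • (inner ℂ (b ⟨m, hm'⟩) w : ℂ) • b ⟨m, hm'⟩ := by
        rw [h4]
        module
      rw [h5]
      exact h3.mono_right (le_of_eq (by ring))
  exact step k (hind k k.2)

lemma mem_polydisc_of_gaugeLe (hr : IsConvexFiniteType r M) (hξ : ξ ∈ bd r)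
    {L : ℝ} (hL : 1 ≤ L) (hbound : ∀ x : Cn n, ‖x‖ ≤ 1 → r (ξ + x) - r ξ ≤ L * ‖x‖)
    (hε : 0 < ε) (hε1 : ε ≤ 1) (hb : IsExtremalBasis r ξ ε (u ξ ε)) {z : Cn n}
    (h : GaugeLe r ξ ε (z - ξ) ((1 + L) * 2 ^ n)⁻¹) : z ∈ polydisc r u ξ ε := by
  refine ⟨fun k => inner ℂ (u ξ ε k) (z - ξ), fun k => ?_, ?_⟩
  · change ‖(inner ℂ (u ξ ε k) (z - ξ) : ℂ)‖ ≤ _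
    rcases eq_or_ne (inner ℂ (u ξ ε k) (z - ξ) : ℂ) 0 with h0 | h0
    · rw [h0, norm_zero]
      exact Real.sSup_nonneg fun c hc => hc.1.le
    · have h1 := hb.gaugeLe_component hr hξ hL hbound hε hε1 (by positivity) h k
      have hv : u ξ ε k ≠ 0 := hb.orthonormal.ne_zero k
      obtain ⟨t, ht⟩ := exists_lt_along_ray hr hξ hv (r ξ + ε)
      refine le_tau_of_gaugeLe hr.convex (h1.mono_right ?_) ⟨t, by rwa [Complex.coe_smul]⟩ h0
      rw [mul_assoc, inv_mul_le_iff₀ (by positivity), mul_one]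
      gcongr
      · exact one_le_two
      · exact k.2.le
  · rw [Orthonormal.sum_inner_smul hb.orthonormal]
    abel

end

section

/-! ### Taylor expansion along lines, with uniform remainder -/

variable {r : Cn n → ℝ} {ξ : Cn n} {ε : ℝ} {w : Cn n} {a : ℝ} {M : ℕ}

/-- The iterated derivative of r of order j at p.1, all in the direction p.2. -/
def dirDeriv (r : Cn n → ℝ) : ℕ → Cn n × Cn n → ℝ
  | 0, p => r p.1
  | j + 1, p => fderiv ℝ (fun x => dirDeriv r j (x, p.2)) p.1 p.2

/-- Joint smoothness in point and direction makes coefficients and remainders uniform over compact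
sets. -/
lemma contDiff_dirDeriv (hr : ContDiff ℝ ∞ r) (j : ℕ) : ContDiff ℝ ∞ (dirDeriv r j) := by
  induction j with
  | zero => exact hr.comp contDiff_fst
  | succ j ih =>
    have h : ContDiff ℝ ∞ (Function.uncurry fun (p : Cn n × Cn n) (x : Cn n) =>
        dirDeriv r j (x, p.2)) :=
      ih.comp (contDiff_snd.prodMk (contDiff_snd.comp contDiff_fst))
    exact h.fderiv_apply contDiff_fst contDiff_snd (by simp)

lemma iteratedDeriv_line (hr : ContDiff ℝ ∞ r) (x v : Cn n) (j : ℕ) :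
    iteratedDeriv j (fun t : ℝ => r (x + t • v)) = fun t => dirDeriv r j (x + t • v, v) := by
  induction j with
  | zero => simp [dirDeriv]
  | succ j ih =>
    rw [iteratedDeriv_succ, ih]
    ext t
    have h1 : Differentiable ℝ fun y => dirDeriv r j (y, v) :=
      ((contDiff_dirDeriv hr j).comp (contDiff_id.prodMk contDiff_const)).differentiable (by simp)
    have h2 : HasDerivAt (fun t : ℝ => x + t • v) v t := by
      simpa using ((hasDerivAt_id t).smul_const v).const_add x
    exact ((h1 (x + t • v)).hasFDerivAt.comp_hasDerivAt t h2).deriv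

/-- The Taylor coefficients of r at p.1 in the direction p.2. -/
def lineCoeff (r : Cn n → ℝ) (j : ℕ) (p : Cn n × Cn n) : ℝ := dirDeriv r j p / j.factorial

lemma continuous_lineCoeff (hr : ContDiff ℝ ∞ r) (j : ℕ) : Continuous (lineCoeff r j) :=
  (contDiff_dirDeriv hr j).continuous.div_const _

lemma exists_taylor_bound (hr : ContDiff ℝ ∞ r) {K : Set (Cn n)} (hK : Bornology.IsBounded K)
    (m : ℕ) : ∃ A : ℝ, 0 ≤ A ∧ ∀ ξ ∈ K, ∀ v : Cn n, ‖v‖ = 1 → ∀ t ∈ Icc (0 : ℝ) 1,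
      |r (ξ + t • v) - ∑ j ∈ Finset.range (m + 1), lineCoeff r j (ξ, v) * t ^ j|
        ≤ A * t ^ (m + 1) := by
  obtain ⟨R, hR⟩ := hK.exists_norm_le
  have hcomp : IsCompact (Metric.closedBall (0 : Cn n) (R + 1) ×ˢ Metric.closedBall (0 : Cn n) 1) :=
    (isCompact_closedBall _ _).prod (isCompact_closedBall _ _)
  obtain ⟨A, hA⟩ := hcomp.exists_bound_of_continuousOn
    (contDiff_dirDeriv hr (m + 1)).continuous.continuousOn
  refine ⟨max A 0, le_max_right _ _, fun ξ hξ v hv t ht => ?_⟩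
  have hline : ContDiff ℝ ∞ fun t : ℝ => r (ξ + t • v) :=
    hr.comp (contDiff_const.add (contDiff_id.smul contDiff_const))
  have hiter : ∀ (j : ℕ), ∀ y ∈ Icc (0 : ℝ) 1,
      iteratedDerivWithin j (fun t : ℝ => r (ξ + t • v)) (Icc 0 1) y =
        dirDeriv r j (ξ + y • v, v) := by
    intro j y hy
    rw [iteratedDerivWithin_eq_iteratedDeriv (uniqueDiffOn_Icc one_pos)
      (hline.contDiffAt.of_le (by exact_mod_cast le_top)) hy, iteratedDeriv_line hr]
  have h := taylor_mean_remainder_bound (f := fun t : ℝ => r (ξ + t • v)) (n := m)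
    (C := max A 0) zero_le_one
    (hline.contDiffOn.of_le (by exact_mod_cast le_top)) ht (by
      intro y hy
      rw [hiter _ y hy]
      refine (hA _ ⟨?_, ?_⟩).trans (le_max_left _ _)
      · rw [mem_closedBall_zero_iff]
        refine (norm_add_le _ _).trans (add_le_add (hR ξ hξ) ?_)
        rw [norm_smul, hv, mul_one, Real.norm_of_nonneg hy.1]
        exact hy.2
      · rw [mem_closedBall_zero_iff]
        exact hv.le)
  rw [taylor_within_apply, Real.norm_eq_abs, sub_zero] at h
  have hsum : ∑ j ∈ Finset.range (m + 1), ((j.factorial : ℝ)⁻¹ * t ^ j) •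
      iteratedDerivWithin j (fun t : ℝ => r (ξ + t • v)) (Icc 0 1) 0 =
      ∑ j ∈ Finset.range (m + 1), lineCoeff r j (ξ, v) * t ^ j := by
    refine Finset.sum_congr rfl fun j _ => ?_
    rw [hiter j 0 (by simp), zero_smul, add_zero, lineCoeff, smul_eq_mul]
    ring
  rw [hsum] at h
  refine h.trans (div_le_self ?_ (by exact_mod_cast Nat.one_le_iff_ne_zero.2 m.factorial_ne_zero))
  have := ht.1
  positivity

/-- The coefficients of a polynomial are controlled by its supremum on an interval. -/
lemma exists_coeff_bound (m : ℕ) : ∃ K : ℝ, 0 ≤ K ∧ ∀ (b : ℕ → ℝ) (c G : ℝ), 0 ≤ c →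
    (∀ t ∈ Icc 0 c, |∑ j ∈ Finset.range m, b j * t ^ j| ≤ G) →
      ∀ j < m, |b j| * c ^ j ≤ K * G := by
  -- Interpolation at the nodes ic/m: scaling the unknowns to b j * c ^ j leaves a Vandermonde
  -- matrix free of c, so the constant does not depend on c.
  set x : Fin m → ℝ := fun i => i / m with hx
  set V := Matrix.vandermonde x with hV
  have hdet : IsUnit V.det := by
    rw [isUnit_iff_ne_zero, hV, Matrix.det_vandermonde_ne_zero_iff]
    intro i j hij
    have hm : (m : ℝ) ≠ 0 := by exact_mod_cast (i.pos).ne'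
    simp only [hx, div_left_inj' hm] at hij
    exact Fin.ext (by exact_mod_cast hij)
  refine ⟨∑ j, ∑ i, |V⁻¹ j i|, by positivity, fun b c G hc hG j hj => ?_⟩
  set y : Fin m → ℝ := fun j => b j * c ^ (j : ℕ) with hy
  have hyV : y = V⁻¹.mulVec (V.mulVec y) := by
    rw [Matrix.mulVec_mulVec, Matrix.nonsing_inv_mul V hdet, Matrix.one_mulVec]
  have hVy : ∀ i, |V.mulVec y i| ≤ G := by
    intro i
    have hm : (0 : ℝ) < m := by exact_mod_cast i.pos
    have hxi : x i * c ∈ Icc 0 c := by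
      refine ⟨by positivity, mul_le_of_le_one_left hc ?_⟩
      rw [hx, div_le_one hm]
      exact_mod_cast i.2.le
    refine le_trans (le_of_eq ?_) (hG _ hxi)
    rw [Finset.sum_range]
    congr 1
    simp only [Matrix.mulVec, dotProduct, hV, Matrix.vandermonde_apply, hy]
    refine Finset.sum_congr rfl fun k _ => ?_
    ring
  have hG0 : 0 ≤ G := (abs_nonneg _).trans (hG 0 ⟨le_rfl, hc⟩)
  have h1 : |b j| * c ^ j = |y ⟨j, hj⟩| := by
    simp only [hy, abs_mul]
    rw [abs_of_nonneg (pow_nonneg hc j)]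
  rw [h1, hyV]
  calc |V⁻¹.mulVec (V.mulVec y) ⟨j, hj⟩| ≤ ∑ i, |V⁻¹ ⟨j, hj⟩ i * V.mulVec y i| := by
        simp only [Matrix.mulVec, dotProduct]
        exact Finset.abs_sum_le_sum_abs _ _
    _ ≤ ∑ i, |V⁻¹ ⟨j, hj⟩ i| * G := by
        refine Finset.sum_le_sum fun i _ => ?_
        rw [abs_mul]
        gcongr
        exact hVy i
    _ = (∑ i, |V⁻¹ ⟨j, hj⟩ i|) * G := by rw [Finset.sum_mul]
    _ ≤ (∑ j, ∑ i, |V⁻¹ j i|) * G := by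
        refine mul_le_mul_of_nonneg_right ?_ hG0
        exact Finset.single_le_sum (f := fun j => ∑ i, |V⁻¹ j i|) (fun _ _ => by positivity)
          (Finset.mem_univ _)

/-! ### Finite type and the doubling property -/

/-- Otherwise the complex line ξ + ℂv would have order of contact at least M + 1 with the boundary,
exceeding the type. -/
lemma exists_lineCoeff_ne_zero (hr : IsConvexFiniteType r M) (hξ : ξ ∈ bd r) {v : Cn n}
    (hv : ‖v‖ = 1) : ∃ θ : ℂ, ‖θ‖ = 1 ∧ ∃ j, 1 ≤ j ∧ j ≤ M ∧ lineCoeff r j (ξ, θ • v) ≠ 0 := by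
  by_contra! hzero
  obtain ⟨A, hA0, hA⟩ := exists_taylor_bound hr.smooth (isCompact_bd hr).isBounded M
  have h0 := eq_zero_of_mem_bd hr.smooth.continuous hξ
  have hbound : ∀ l : ℂ, ‖l‖ ≤ 1 → |r (ξ + l • v)| ≤ A * ‖l‖ ^ (M + 1) := by
    intro l hl
    rcases eq_or_ne l 0 with rfl | hl0
    · simp [h0]
    have hl0' := norm_pos_iff.2 hl0
    set θ : ℂ := ((‖l‖⁻¹ : ℝ) : ℂ) * l with hθ
    have hθ1 : ‖θ‖ = 1 := by
      rw [hθ, norm_mul, Complex.norm_real, norm_inv, norm_norm, inv_mul_cancel₀ hl0'.ne']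
    have h1 := hA ξ hξ (θ • v) (by rw [norm_smul, hθ1, hv, one_mul]) ‖l‖ ⟨norm_nonneg _, hl⟩
    have hsum : ∑ j ∈ Finset.range (M + 1), lineCoeff r j (ξ, θ • v) * ‖l‖ ^ j = 0 := by
      refine Finset.sum_eq_zero fun j hj => ?_
      rcases Nat.eq_zero_or_pos j with rfl | hj0
      · simp [lineCoeff, dirDeriv, h0]
      · rw [hzero θ hθ1 j hj0 (by simpa [Nat.lt_succ_iff] using hj), zero_mul]
    have hl' : ‖l‖ • θ • v = l • v := by
      rw [← Complex.coe_smul, smul_smul, hθ, ← mul_assoc, ← Complex.ofReal_mul,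
        mul_inv_cancel₀ hl0'.ne', Complex.ofReal_one, one_mul]
    rwa [hsum, sub_zero, hl'] at h1
  set F : Cn 1 → Cn n := fun w => ξ + w 0 • v with hF
  set P : Cn 1 →L[ℂ] Cn n := (EuclideanSpace.proj (0 : Fin 1) : Cn 1 →L[ℂ] ℂ).smulRight v with hP
  have hFP : F = fun w => ξ + P w := by
    ext w i
    simp [hF, hP]
  have hnorm : ∀ w : Cn 1, ‖w‖ = ‖w 0‖ := by
    intro w
    simp [EuclideanSpace.norm_eq]
  have hv0 : v ≠ 0 := by
    rintro rfl
    simp at hv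
  have hgerm : IsNonsingularGerm ξ F := by
    refine ⟨one_pos, ?_, by simp [hF], ?_⟩
    · rw [hFP]
      exact analyticAt_const.add (P.analyticAt 0)
    · have : fderiv ℂ F 0 = P := by
        rw [hFP]
        simp
      rw [this, injective_iff_map_eq_zero]
      intro w hw
      have : w 0 = 0 := by simpa [hP, hv0] using hw
      rw [← norm_eq_zero, hnorm, this, norm_zero]
  have hO : (fun w => r (F w)) =O[𝓝 0] (fun w : Cn 1 => ‖w‖ ^ (M + 1)) := by
    refine IsBigO.of_bound A ?_
    filter_upwards [Metric.closedBall_mem_nhds (0 : Cn 1) one_pos] with w hw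
    rw [mem_closedBall_zero_iff, hnorm] at hw
    rw [Real.norm_eq_abs, norm_pow, norm_norm, hnorm]
    exact hbound _ hw
  have h1 : ((M + 1 : ℕ) : ℕ∞) ≤ contactOrder r F :=
    le_iSup₂_of_le (f := fun (s : ℕ) (_ : (fun w => r (F w)) =O[𝓝 0] (fun w : Cn 1 => ‖w‖ ^ s)) =>
      (s : ℕ∞)) (M + 1) hO le_rfl
  have h2 : contactOrder r F ≤ pointType r ξ :=
    le_iSup_of_le 1 (le_iSup₂_of_le (f := fun (F : Cn 1 → Cn n) (_ : IsNonsingularGerm ξ F) =>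
      contactOrder r F) F hgerm le_rfl)
  have h3 : pointType r ξ ≤ domainType r :=
    le_iSup₂_of_le (f := fun (p : Cn n) (_ : p ∈ bd r) => pointType r p) ξ hξ le_rfl
  have h4 := (h1.trans h2).trans h3
  rw [hr.type_eq] at h4
  have : M + 1 ≤ M := by exact_mod_cast h4
  omega

/-- Near each (ξ, v) the same θ and j work with half the value; finitely many such neighborhoods
suffice. -/
lemma exists_lineCoeff_lower_bound (hr : IsConvexFiniteType r M) :
    ∃ σ : ℝ, 0 < σ ∧ ∀ ξ ∈ bd r, ∀ v : Cn n, ‖v‖ = 1 →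
      ∃ θ : ℂ, ‖θ‖ = 1 ∧ ∃ j, 1 ≤ j ∧ j ≤ M ∧ σ ≤ |lineCoeff r j (ξ, θ • v)| := by
  have hcomp : IsCompact (bd r ×ˢ Metric.sphere (0 : Cn n) 1) :=
    (isCompact_bd hr).prod (isCompact_sphere _ _)
  have key : ∃ σ : ℝ, 0 < σ ∧ ∀ p ∈ bd r ×ˢ Metric.sphere (0 : Cn n) 1,
      ∃ θ : ℂ, ‖θ‖ = 1 ∧ ∃ j, 1 ≤ j ∧ j ≤ M ∧ σ ≤ |lineCoeff r j (p.1, θ • p.2)| := by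
    refine hcomp.induction_on (p := fun s => ∃ σ : ℝ, 0 < σ ∧ ∀ p ∈ s,
      ∃ θ : ℂ, ‖θ‖ = 1 ∧ ∃ j, 1 ≤ j ∧ j ≤ M ∧ σ ≤ |lineCoeff r j (p.1, θ • p.2)|)
      ⟨1, one_pos, by simp⟩ ?_ ?_ ?_
    · rintro s t hst ⟨σ, hσ, h⟩
      exact ⟨σ, hσ, fun p hp => h p (hst hp)⟩
    · rintro s t ⟨σ, hσ, h⟩ ⟨σ', hσ', h'⟩
      refine ⟨min σ σ', lt_min hσ hσ', ?_⟩
      rintro p (hp | hp)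
      · obtain ⟨θ, hθ, j, h1, h2, h3⟩ := h p hp
        exact ⟨θ, hθ, j, h1, h2, (min_le_left _ _).trans h3⟩
      · obtain ⟨θ, hθ, j, h1, h2, h3⟩ := h' p hp
        exact ⟨θ, hθ, j, h1, h2, (min_le_right _ _).trans h3⟩
    · rintro ⟨ξ, v⟩ ⟨hξ, hv⟩
      obtain ⟨θ, hθ, j, h1, h2, h3⟩ :=
        exists_lineCoeff_ne_zero hr hξ (by simpa using hv)
      have h3' : |lineCoeff r j (ξ, θ • v)| / 2 < |lineCoeff r j (ξ, θ • v)| :=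
        half_lt_self (abs_pos.2 h3)
      have hc : Continuous fun p : Cn n × Cn n => |lineCoeff r j (p.1, θ • p.2)| :=
        ((continuous_lineCoeff hr.smooth j).comp
          (continuous_fst.prodMk (continuous_snd.const_smul θ))).abs
      refine ⟨_, mem_nhdsWithin_of_mem_nhds ((hc.tendsto (ξ, v)).eventually (lt_mem_nhds h3')),
        |lineCoeff r j (ξ, θ • v)| / 2, half_pos (abs_pos.2 h3), fun p hp => ?_⟩
      exact ⟨θ, hθ, j, h1, h2, le_of_lt hp⟩
  obtain ⟨σ, hσ, h⟩ := key
  exact ⟨σ, hσ, fun ξ hξ v hv => h (ξ, v) ⟨hξ, by simpa using hv⟩⟩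

/-- On short complex discs the growth of r satisfies a doubling condition, and is at least a
fixed power of the radius. -/
lemma exists_disc_doubling (hr : IsConvexFiniteType r M) :
    ∃ K c₀ κ : ℝ, 1 ≤ K ∧ 0 < c₀ ∧ 0 < κ ∧ ∀ ξ ∈ bd r, ∀ v : Cn n, ‖v‖ = 1 → ∀ c E : ℝ,
      0 < c → c ≤ c₀ → (∀ l : ℂ, ‖l‖ ≤ c → r (ξ + l • v) ≤ r ξ + E) →
        κ * c ^ M ≤ E ∧ ∀ l : ℂ, ‖l‖ ≤ 2 * c → r (ξ + l • v) ≤ r ξ + K * E := by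
  obtain ⟨A, hA0, hA⟩ := exists_taylor_bound hr.smooth (isCompact_bd hr).isBounded M
  obtain ⟨σ, hσ, hlow⟩ := exists_lineCoeff_lower_bound hr
  obtain ⟨B, hB0, hB⟩ := exists_coeff_bound (M + 1)
  -- The bound 1/2 keeps the doubled disc within Taylor range; the other makes B * A * c ≤ σ / 2, so
  -- the remainder is absorbed by the lower bound σ.
  set c₀ : ℝ := min (1 / 2) (σ / (2 * (B * A + 1))) with hc₀
  set K₂ : ℝ := 2 * B * A / σ with hK₂
  set K : ℝ := (M + 1) * (2 ^ M * (B * (1 + K₂))) + 2 ^ (M + 1) * K₂ with hK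
  have hK₂0 : 0 ≤ K₂ := by positivity
  have hK0 : 0 ≤ K := by positivity
  refine ⟨max 1 K, c₀, σ / (2 * (B + 1)), le_max_left _ _, by positivity, by positivity, ?_⟩
  intro ξ hξ v hv c E hc hcc₀ hE
  have h0 := eq_zero_of_mem_bd hr.smooth.continuous hξ
  have hc2 : c ≤ 1 / 2 := hcc₀.trans (min_le_left _ _)
  have hE0 : 0 ≤ E := by simpa using hE 0 (by simpa using hc.le)
  have habs : ∀ l : ℂ, ‖l‖ ≤ c → |r (ξ + l • v)| ≤ E := by
    intro l hl
    have h := GaugeLe.abs_sub_le (ε := E) (w := v) (a := c⁻¹) (l := l) hr.convex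
      (fun l hl => hE l (by rwa [← div_eq_mul_inv, div_le_one hc] at hl))
      (by rwa [← div_eq_mul_inv, div_le_one hc])
    rwa [h0, sub_zero] at h
  have hunit : ∀ θ : ℂ, ‖θ‖ = 1 → ‖θ • v‖ = 1 := fun θ hθ => by rw [norm_smul, hθ, hv, one_mul]
  have hcoef : ∀ θ : ℂ, ‖θ‖ = 1 → ∀ j < M + 1,
      |lineCoeff r j (ξ, θ • v)| * c ^ j ≤ B * (E + A * c ^ (M + 1)) := by
    intro θ hθ
    refine hB _ c _ hc.le fun t ht => ?_
    have h1 := hA ξ hξ (θ • v) (hunit θ hθ) t ⟨ht.1, by linarith [ht.2]⟩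
    have h2 := habs (t * θ) (by
      rw [norm_mul, hθ, mul_one, Complex.norm_real, Real.norm_of_nonneg ht.1]
      exact ht.2)
    rw [mul_smul, Complex.coe_smul] at h2
    have h3 : A * t ^ (M + 1) ≤ A * c ^ (M + 1) := by
      gcongr
      · exact ht.1
      · exact ht.2
    rw [abs_sub_comm] at h1
    have h4 := abs_add_le (∑ j ∈ Finset.range (M + 1), lineCoeff r j (ξ, θ • v) * t ^ j -
      r (ξ + t • θ • v)) (r (ξ + t • θ • v))
    rw [sub_add_cancel] at h4
    linarith
  have hσE : σ * c ^ M ≤ 2 * B * E := by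
    obtain ⟨θ, hθ, j, h1, h2, h3⟩ := hlow ξ hξ v hv
    have h4 := hcoef θ hθ j (by omega)
    have h5 : c ^ M ≤ c ^ j := pow_le_pow_of_le_one hc.le (by linarith) h2
    have h6 : σ * c ^ M ≤ |lineCoeff r j (ξ, θ • v)| * c ^ j := by gcongr
    have h7 : B * A * c ≤ σ / 2 := by
      have : c ≤ σ / (2 * (B * A + 1)) := hcc₀.trans (min_le_right _ _)
      rw [le_div_iff₀ (by positivity)] at this
      nlinarith
    have h8 : B * (A * c ^ (M + 1)) ≤ σ / 2 * c ^ M := by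
      calc B * (A * c ^ (M + 1)) = (B * A * c) * c ^ M := by ring
        _ ≤ σ / 2 * c ^ M := by gcongr
    nlinarith
  -- The remainder is now bounded by a multiple of E, hence so is every scaled coefficient, and
  -- doubling the radius costs only powers of 2.
  have hAE : A * c ^ M ≤ K₂ * E := by
    rw [hK₂, div_mul_eq_mul_div, le_div_iff₀ hσ]
    nlinarith
  have hAE' : A * c ^ (M + 1) ≤ K₂ * E := by
    refine le_trans ?_ hAE
    gcongr A * ?_
    exact pow_le_pow_of_le_one hc.le (by linarith) (Nat.le_succ M)
  refine ⟨?_, fun l hl => ?_⟩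
  · rw [div_mul_eq_mul_div, div_le_iff₀ (by positivity)]
    nlinarith
  rcases eq_or_ne l 0 with rfl | hl0
  · simp only [zero_smul, add_zero]
    have : 0 ≤ max 1 K * E := by positivity
    linarith
  have hl0' := norm_pos_iff.2 hl0
  set θ : ℂ := ((‖l‖⁻¹ : ℝ) : ℂ) * l with hθ
  have hθ1 : ‖θ‖ = 1 := by
    rw [hθ, norm_mul, Complex.norm_real, norm_inv, norm_norm, inv_mul_cancel₀ hl0'.ne']
  have hl' : ‖l‖ • θ • v = l • v := by
    rw [← Complex.coe_smul, smul_smul, hθ, ← mul_assoc, ← Complex.ofReal_mul,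
      mul_inv_cancel₀ hl0'.ne', Complex.ofReal_one, one_mul]
  have h1 := hA ξ hξ (θ • v) (hunit θ hθ1) ‖l‖ ⟨norm_nonneg _, by linarith⟩
  rw [hl'] at h1
  have h2 : ∑ j ∈ Finset.range (M + 1), lineCoeff r j (ξ, θ • v) * ‖l‖ ^ j ≤
      ∑ j ∈ Finset.range (M + 1), 2 ^ M * (B * (E + A * c ^ (M + 1))) := by
    refine Finset.sum_le_sum fun j hj => ?_
    have hj' : j ≤ M := by simpa [Nat.lt_succ_iff] using hj
    calc lineCoeff r j (ξ, θ • v) * ‖l‖ ^ j ≤ |lineCoeff r j (ξ, θ • v)| * (2 * c) ^ j := by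
          gcongr
          exact le_abs_self _
      _ = 2 ^ j * (|lineCoeff r j (ξ, θ • v)| * c ^ j) := by ring
      _ ≤ 2 ^ M * (B * (E + A * c ^ (M + 1))) := by
          refine mul_le_mul (pow_le_pow_right₀ one_le_two hj') (hcoef θ hθ1 j (by omega))
            (by positivity) (by positivity)
  rw [Finset.sum_const, Finset.card_range, nsmul_eq_mul] at h2
  have h3 : A * ‖l‖ ^ (M + 1) ≤ 2 ^ (M + 1) * (K₂ * E) := by
    calc A * ‖l‖ ^ (M + 1) ≤ A * (2 * c) ^ (M + 1) := by gcongr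
      _ = 2 ^ (M + 1) * (A * c ^ (M + 1)) := by ring
      _ ≤ _ := by gcongr
  have h4 : ((M + 1 : ℕ) : ℝ) * (2 ^ M * (B * (E + A * c ^ (M + 1)))) ≤
      (M + 1) * (2 ^ M * (B * (E + K₂ * E))) := by
    push_cast
    gcongr
  have h5 : r (ξ + l • v) ≤ K * E := by
    have := (abs_le.1 h1).2
    calc r (ξ + l • v) ≤ (M + 1) * (2 ^ M * (B * (E + K₂ * E))) + 2 ^ (M + 1) * (K₂ * E) := by
          linarith
      _ = K * E := by rw [hK]; ring
  rw [h0, zero_add]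
  exact h5.trans (by gcongr; exact le_max_right _ _)

/-- Gauge a for w means a disc of radius ‖w‖ / a in the unit direction. The threshold κ c₀ ^ M / 2
excludes radii above c₀, by the lower growth bound. -/
lemma exists_gauge_doubling (hr : IsConvexFiniteType r M) :
    ∃ K ε₀ : ℝ, 1 ≤ K ∧ 0 < ε₀ ∧ ∀ ξ ∈ bd r, ∀ ε : ℝ, 0 < ε → ε ≤ ε₀ → ∀ (w : Cn n) (a : ℝ),
      0 < a → GaugeLe r ξ ε w a → GaugeLe r ξ (K * ε) w (a / 2) := by
  obtain ⟨K, c₀, κ, hK, hc₀, hκ, h⟩ := exists_disc_doubling hr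
  refine ⟨K, κ * c₀ ^ M / 2, hK, by positivity, fun ξ hξ ε hε hεε₀ w a ha hg => ?_⟩
  rcases eq_or_ne w 0 with rfl | hw
  · exact gaugeLe_zero (by positivity)
  have hw' := norm_pos_iff.2 hw
  set v : Cn n := ((‖w‖⁻¹ : ℝ) : ℂ) • w with hv
  have hn : ‖((‖w‖⁻¹ : ℝ) : ℂ)‖ = ‖w‖⁻¹ := by rw [Complex.norm_real, norm_inv, norm_norm]
  have hv1 : ‖v‖ = 1 := by rw [hv, norm_smul, hn, inv_mul_cancel₀ hw'.ne']
  have hwv : w = (‖w‖ : ℂ) • v := by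
    rw [hv, smul_smul, ← Complex.ofReal_mul, mul_inv_cancel₀ hw'.ne', Complex.ofReal_one, one_smul]
  have hgv : GaugeLe r ξ ε v (‖w‖⁻¹ * a) := by
    have := hg.smul ((‖w‖⁻¹ : ℝ) : ℂ)
    rwa [hn] at this
  have hdisc : ∀ l : ℂ, ‖l‖ ≤ ‖w‖ / a → r (ξ + l • v) ≤ r ξ + ε := by
    intro l hl
    refine hgv l ?_
    rw [le_div_iff₀ ha] at hl
    calc ‖l‖ * (‖w‖⁻¹ * a) = (‖l‖ * a) * ‖w‖⁻¹ := by ring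
      _ ≤ ‖w‖ * ‖w‖⁻¹ := by gcongr
      _ = 1 := mul_inv_cancel₀ hw'.ne'
  have hle : ‖w‖ / a ≤ c₀ := by
    by_contra! hlt
    have := (h ξ hξ v hv1 c₀ ε hc₀ le_rfl fun l hl => hdisc l (hl.trans hlt.le)).1
    have : 0 < κ * c₀ ^ M := by positivity
    linarith
  have h2 := (h ξ hξ v hv1 (‖w‖ / a) ε (by positivity) hle hdisc).2
  intro l hl
  rw [hwv, smul_smul]
  refine h2 _ ?_
  rw [norm_mul, Complex.norm_real, norm_norm, mul_div_assoc', le_div_iff₀ ha]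
  nlinarith

lemma exists_gauge_doubling_iter (hr : IsConvexFiniteType r M) (m : ℕ) :
    ∃ K ε₀ : ℝ, 1 ≤ K ∧ 0 < ε₀ ∧ ∀ ξ ∈ bd r, ∀ ε : ℝ, 0 < ε → ε ≤ ε₀ → ∀ (w : Cn n) (a : ℝ),
      0 < a → GaugeLe r ξ ε w a → GaugeLe r ξ (K * ε) w (a / 2 ^ m) := by
  obtain ⟨K, ε₀, hK, hε₀, h⟩ := exists_gauge_doubling hr
  induction m with
  | zero => exact ⟨1, 1, le_rfl, one_pos, fun ξ _ ε _ _ w a _ hg => by simpa using hg⟩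
  | succ m ih =>
    obtain ⟨K', ε₁, hK', hε₁, h'⟩ := ih
    refine ⟨K * K', min ε₁ (ε₀ / K'), one_le_mul_of_one_le_of_one_le hK hK', by positivity, ?_⟩
    intro ξ hξ ε hε hle w a ha hg
    have h1 := h' ξ hξ ε hε (hle.trans (min_le_left _ _)) w a ha hg
    have h2 : K' * ε ≤ ε₀ := by
      have := hle.trans (min_le_right _ _)
      rwa [le_div_iff₀' (by positivity)] at this
    have h3 := h ξ hξ (K' * ε) (by positivity) h2 w _ (by positivity) h1
    rw [← mul_assoc] at h3
    exact h3.mono_right (le_of_eq (by rw [pow_succ]; field_simp))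

/-- The engulfing property of the polydiscs: the points at distance at most 3ε from the polydisc
of size ε lie in the polydisc of a comparable size, whatever the choice of extremal bases. -/
lemma exists_polydisc_engulfing (hr : IsConvexFiniteType r M) :
    ∃ C₁ ε₁ : ℝ, 1 < C₁ ∧ 0 < ε₁ ∧ ∀ u : Cn n → ℝ → Fin n → Cn n, IsExtremalChoice r u →
      ∀ ζ ∈ bd r, ∀ ε' ε : ℝ, 0 < ε' → ε' ≤ ε → ε ≤ ε₁ → ∀ p ∈ polydisc r u ζ ε', ∀ q : Cn n,
        ‖q - p‖ ≤ 3 * ε → q ∈ polydisc r u ζ (C₁ * ε) := by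
  obtain ⟨L, hL, hbound⟩ := exists_growth_bound hr
  -- The first factor bounds the gauge of q - ζ (polydisc plus displacement 3ε); the second is the
  -- loss in returning from gauge to polydisc.
  set S : ℝ := (2 * (n + 1) + 3 * L) * ((1 + L) * 2 ^ n) with hS
  obtain ⟨m, hm⟩ := pow_unbounded_of_one_lt S (one_lt_two : (1 : ℝ) < 2)
  obtain ⟨K, ε₀, hK, hε₀, hdoub⟩ := exists_gauge_doubling_iter hr m
  -- The factor 2 gives C₁ > 1 from K ≥ 1; the bound (2 * K)⁻¹ keeps the enlarged scale at most 1.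
  refine ⟨2 * K, min (min ε₀ 1) (2 * K)⁻¹, by linarith, by positivity, ?_⟩
  intro u hu ζ hζ ε' ε hε' hle hε₁ p hp q hq
  have hε : 0 < ε := hε'.trans_le hle
  have hεε₀ : ε ≤ ε₀ := hε₁.trans ((min_le_left _ _).trans (min_le_left _ _))
  have hε1 : ε ≤ 1 := hε₁.trans ((min_le_left _ _).trans (min_le_right _ _))
  have hεK : 2 * K * ε ≤ 1 := by
    have := hε₁.trans (min_le_right _ _)
    rwa [le_inv_comm₀ hε (by positivity), ← one_div, le_div_iff₀ hε] at this
  -- Passing from ε' to ε is done on gauges, which are monotone in the scale, since the bases may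
  -- change with it.
  have h1 := (gaugeLe_of_mem_polydisc hr.convex hε'.le hp).mono_left hle
  have h2 := gaugeLe_of_norm_le hL (hbound ζ hζ) hε hε1 hq
  have h3 := h1.add hr.convex (by positivity) (by positivity) h2
  have h4 := hdoub ζ hζ ε hε hεε₀ _ _ (by positivity) h3
  rw [add_comm, sub_add_sub_cancel] at h4
  refine mem_polydisc_of_gaugeLe hr hζ hL (hbound ζ hζ) (by positivity) hεK
    (hu ζ hζ _ (by positivity)) ((h4.mono_left (by nlinarith)).mono_right ?_)
  rw [div_le_iff₀ (by positivity), inv_mul_eq_div, le_div_iff₀ (by positivity)]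
  exact hm.le

end

section

/-! ### The two projections near the boundary -/

variable {r : Cn n → ℝ} {M : ℕ} {U V : Set (Cn n)} {t₀ : ℝ} {φ : Cn n → ℝ → Cn n}

/-- The field ∇r/|∇r|², along which r grows with unit speed. -/
def normalField (r : Cn n → ℝ) (x : Cn n) : Cn n := (‖gradient r x‖ ^ 2)⁻¹ • gradient r x

lemma norm_normalField_le {x : Cn n} (h : 2 / 3 ≤ ‖gradient r x‖) : ‖normalField r x‖ ≤ 3 / 2 := by
  have h0 : 0 < ‖gradient r x‖ := by linarith
  rw [normalField, norm_smul, norm_inv, norm_pow, norm_norm]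
  have : (‖gradient r x‖ ^ 2)⁻¹ * ‖gradient r x‖ = ‖gradient r x‖⁻¹ := by field_simp
  rw [this, inv_le_comm₀ h0 (by norm_num)]
  linarith

lemma inner_gradient_normalField {x : Cn n} (h : gradient r x ≠ 0) :
    (inner ℝ (gradient r x) (normalField r x) : ℝ) = 1 := by
  have h0 : ‖gradient r x‖ ≠ 0 := norm_ne_zero_iff.2 h
  rw [normalField, real_inner_smul_right, real_inner_self_eq_norm_sq]
  field_simp

lemma contDiff_gradient (hr : ContDiff ℝ ∞ r) : ContDiff ℝ 1 (gradient r) := by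
  have h : ContDiff ℝ 1 (fderiv ℝ r) := hr.fderiv_right (by norm_cast)
  exact (InnerProductSpace.toDual ℝ (Cn n)).symm.contDiff.comp h

lemma contDiffOn_normalField (hr : ContDiff ℝ ∞ r) {s : Set (Cn n)}
    (hs : ∀ x ∈ s, gradient r x ≠ 0) : ContDiffOn ℝ 1 (normalField r) s := by
  have hg := (contDiff_gradient hr).contDiffOn (s := s)
  exact ((hg.norm_sq ℝ).inv fun x hx => by simpa using hs x hx).smul hg

/-- Off a δ-neighborhood of the boundary, the closed domain is compact and r has a negative maximum
there. -/
lemma exists_thickening_of_level (hr : IsConvexFiniteType r M) {δ : ℝ} (hδ : 0 < δ) :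
    ∃ τ : ℝ, 0 < τ ∧ ∀ z ∈ dom r, -τ < r z → ∃ p ∈ bd r, dist z p < δ := by
  have hcont := hr.smooth.continuous
  set K := closure (dom r) \ Metric.thickening δ (bd r) with hK
  have hKc : IsCompact K := (isCompact_closure_dom hr).diff Metric.isOpen_thickening
  have hKneg : ∀ z ∈ K, r z < 0 := by
    rintro z ⟨hz, hz'⟩
    by_contra! h0
    have hle : r z ≤ 0 := closure_lt_subset_le hcont continuous_const hz
    exact hz' (Metric.self_subset_thickening hδ _
      (mem_bd_of_mem_closure hcont (le_antisymm hle h0) hz))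
  have hout : ∀ z ∈ dom r, z ∉ K → ∃ p ∈ bd r, dist z p < δ := by
    intro z hz hzK
    rw [hK, Set.mem_sdiff, not_and_not_right] at hzK
    exact Metric.mem_thickening_iff.1 (hzK (subset_closure hz))
  rcases K.eq_empty_or_nonempty with he | hne
  · exact ⟨1, one_pos, fun z hz _ => hout z hz (by simp [he])⟩
  · obtain ⟨y, hy, hmax⟩ := hKc.exists_isMaxOn hne hcont.continuousOn
    refine ⟨-r y, neg_pos.2 (hKneg y hy), fun z hz hlt => hout z hz fun hzK => ?_⟩
    have : r z ≤ r y := hmax hzK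
    linarith

lemma IsNormalFlow.hasDerivWithinAt_Ici (hφ : IsNormalFlow r U V t₀ φ) {x : Cn n} (hx : x ∈ V)
    {t : ℝ} (ht : t ∈ Ico 0 t₀) :
    HasDerivWithinAt (φ x) (-normalField r (φ x t)) (Ici t) t :=
  (hφ.ode x hx t ht).mono_of_mem_nhdsWithin
    (mem_of_superset (Ico_mem_nhdsGE ht.2) (Ico_subset_Ico_left ht.1))

lemma IsNormalFlow.norm_sub_le (hU : IsAdmissibleNhd r U) (hφ : IsNormalFlow r U V t₀ φ)
    {x : Cn n} (hx : x ∈ V) {t : ℝ} (ht : t ∈ Ico 0 t₀) : ‖φ x t - x‖ ≤ 3 / 2 * t := by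
  have hmem : ∀ s ∈ Icc 0 t, s ∈ Ico 0 t₀ := fun s hs => ⟨hs.1, hs.2.trans_lt ht.2⟩
  have h := norm_image_sub_le_of_norm_deriv_le_segment' (f := φ x)
    (f' := fun s => -normalField r (φ x s)) (C := 3 / 2) (a := 0) (b := t)
    (fun s hs => (hφ.ode x hx s (hmem s hs)).mono hmem)
    (fun s hs => by
      rw [norm_neg]
      exact norm_normalField_le
        (hU.grad _ (hφ.mem x hx s (hmem s (Ico_subset_Icc_self hs)))).1)
    t ⟨ht.1, le_rfl⟩
  rwa [hφ.init x hx, sub_zero] at h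

lemma norm_sub_proj_le (hU : IsAdmissibleNhd r U) (hφ : IsNormalFlow r U V t₀ φ)
    {z p q : Cn n} (hp : IsNearest r z p) (hq : IsFlowProj r t₀ φ z q) :
    ‖p - q‖ ≤ 3 * (-r z) := by
  have h1 := hφ.norm_sub_le hU (subset_of_mem_nhdsSet hφ.nhd hq.1) hq.2.1
  rw [hq.2.2, ← dist_eq_norm] at h1
  have h2 : dist z p ≤ dist z q := hp.2.trans_le (Metric.infDist_le_dist_of_mem hq.1)
  have h3 := dist_triangle_left p q z
  rw [← dist_eq_norm]
  linarith

/-- Solutions of an autonomous equation on a ball on which the field is bounded by L, for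
times so short that they cannot leave the ball. -/
lemma exists_solution_mem_closedBall {E : Type*} [NormedAddCommGroup E] [NormedSpace ℝ E]
    [CompleteSpace E] {X : E → E} {z : E} {ρ L K : NNReal}
    (hX : LipschitzOnWith K X (Metric.closedBall z ρ))
    (hbound : ∀ x ∈ Metric.closedBall z ρ, ‖X x‖ ≤ L) {T : ℝ} (hT : 0 ≤ T) (hLT : L * T ≤ ρ) :
    ∃ β : ℝ → E, Continuous β ∧ β 0 = z ∧ (∀ t, β t ∈ Metric.closedBall z ρ) ∧
      ∀ t ∈ Icc 0 T, HasDerivWithinAt β (X (β t)) (Icc 0 T) t := by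
  have h0 : (0 : ℝ) ∈ Icc 0 T := ⟨le_rfl, hT⟩
  have hf : IsPicardLindelof (fun _ => X) ⟨0, h0⟩ z ρ 0 L K :=
    IsPicardLindelof.of_time_independent hbound hX (by
      simpa [max_eq_left hT] using hLT)
  have hz : z ∈ Metric.closedBall z ((0 : NNReal) : ℝ) := by simp
  obtain ⟨γ, hγ⟩ := ODE.FunSpace.exists_isFixedPt_next hf hz
  obtain ⟨α, hα⟩ : ∃ α, α = ODE.FunSpace.next hf hz γ := ⟨_, rfl⟩
  have hpic : ∀ t ∈ Icc 0 T, α.compProj t = ODE.picard (fun _ => X) 0 z α.compProj t := by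
    intro t ht
    rw [hα, ODE.FunSpace.compProj_apply, ODE.FunSpace.next_apply, hγ, projIcc_of_mem _ ht]
  have hmem : ∀ t, α.compProj t ∈ Metric.closedBall z ρ :=
    fun t => α.compProj_mem_closedBall hf.mul_max_le
  refine ⟨α.compProj, α.continuous_compProj, ?_, hmem, fun t ht => ?_⟩
  · rw [hpic 0 h0]
    exact ODE.picard_apply₀
  · refine (ODE.hasDerivWithinAt_picard_Icc (f := fun _ => X) (u := Metric.closedBall z ρ)
      h0 ?_ α.continuous_compProj.continuousOn (fun t _ => hmem t) z ht).congr hpic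
      (hpic t ht)
    exact hX.continuousOn.comp continuousOn_snd fun x hx => hx.2

/-- Follow ∇r/|∇r|² from z for time -r(z): r grows at unit rate and reaches 0 at a boundary point q.
By uniqueness, the given flow from q retraces this curve. The threshold is independent of φ. -/
lemma exists_flowProj (hr : IsConvexFiniteType r M) (hU : IsAdmissibleNhd r U)
    (hV : V ∈ 𝓝ˢ (bd r)) (hVU : V ⊆ U) (ht₀ : 0 < t₀) :
    ∃ τ : ℝ, 0 < τ ∧ ∀ φ : Cn n → ℝ → Cn n, IsNormalFlow r U V t₀ φ → ∀ z ∈ dom r, -τ < r z →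
      z ∈ V ∧ ∃ q, IsFlowProj r t₀ φ z q := by
  have hcont := hr.smooth.continuous
  obtain ⟨δ, hδ, hδV⟩ := (isCompact_bd hr).exists_cthickening_subset_open isOpen_interior
    (subset_interior_iff_mem_nhdsSet.2 hV)
  obtain ⟨τ, hτ, hnear⟩ := exists_thickening_of_level hr (half_pos hδ)
  -- With T < δ/8, the path from z to q and the flow back each move at most 3T/2, so both stay in
  -- the ball of radius δ/2 about z, itself inside V.
  refine ⟨min τ (min t₀ (δ / 8)), by positivity, fun φ hφ z hz hzτ => ?_⟩
  obtain ⟨p, hp, hzp⟩ := hnear z hz (by linarith [min_le_left τ (min t₀ (δ / 8))])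
  set T := -r z with hT
  have hTt₀ : T < t₀ := by
    linarith [(min_le_right τ (min t₀ (δ / 8))).trans (min_le_left _ _)]
  have hTδ : T < δ / 8 := by
    linarith [(min_le_right τ (min t₀ (δ / 8))).trans (min_le_right _ _)]
  have hT0 : 0 < T := neg_pos.2 hz
  have hball : Metric.closedBall z (δ / 2) ⊆ V := by
    intro x hx
    refine interior_subset (hδV (Metric.mem_cthickening_of_dist_le x p δ _ hp ?_))
    have := dist_triangle x z p
    rw [Metric.mem_closedBall] at hx
    linarith
  have hgrad : ∀ x ∈ Metric.closedBall z (δ / 2), 2 / 3 ≤ ‖gradient r x‖ :=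
    fun x hx => (hU.grad x (hVU (hball hx))).1
  have hgrad0 : ∀ x ∈ Metric.closedBall z (δ / 2), gradient r x ≠ 0 := by
    intro x hx h0
    have := hgrad x hx
    rw [h0, norm_zero] at this
    linarith
  obtain ⟨K, hK⟩ := (contDiffOn_normalField hr.smooth hgrad0).exists_lipschitzOnWith one_ne_zero
    (convex_closedBall _ _) (isCompact_closedBall _ _)
  obtain ⟨β, hβc, hβ0, hβmem, hβ⟩ := exists_solution_mem_closedBall
    (ρ := ⟨δ / 2, by positivity⟩) (L := ⟨3 / 2, by norm_num⟩) hK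
    (fun x hx => norm_normalField_le (hgrad x hx)) hT0.le
    (show 3 / 2 * T ≤ δ / 2 by linarith)
  replace hβmem : ∀ t, β t ∈ Metric.closedBall z (δ / 2) := hβmem
  refine ⟨hball (Metric.mem_closedBall_self (by positivity)), β T, ?_⟩
  have hlevel : ∀ t ∈ Icc 0 T, r (β t) = r z + t := by
    intro t ht
    have h := constant_of_has_deriv_right_zero (f := fun t => r (β t) - t) (a := 0) (b := T)
      ((hcont.comp hβc).sub continuous_id).continuousOn (fun s hs => by
        have h1 : HasFDerivAt r (innerSL ℝ (gradient r (β s))) (β s) :=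
          (hr.smooth.differentiable (by simp) (β s)).hasGradientAt
        have h2 : HasDerivWithinAt β (normalField r (β s)) (Ici s) s :=
          (hβ s (Ico_subset_Icc_self hs)).mono_of_mem_nhdsWithin
            (mem_of_superset (Icc_mem_nhdsGE hs.2) (Icc_subset_Icc_left hs.1))
        have h3 := (h1.comp_hasDerivWithinAt s h2).sub (hasDerivWithinAt_id s (Ici s))
        rw [innerSL_apply_apply, inner_gradient_normalField (hgrad0 _ (hβmem s)), sub_self] at h3
        exact h3) t ht
    simp only [hβ0] at h
    linarith
  -- The boundary is a frontier, so level 0 alone is not used: β T is also a limit of interior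
  -- points.
  have hcl : β T ∈ closure (dom r) := by
    have h1 : T ∈ closure (Ico 0 T) := by
      rw [closure_Ico hT0.ne]
      exact ⟨hT0.le, le_rfl⟩
    refine closure_mono ?_ (image_closure_subset_closure_image hβc ⟨T, h1, rfl⟩)
    rintro _ ⟨t, ht, rfl⟩
    have := hlevel t (Ico_subset_Icc_self ht)
    have := ht.2
    change r (β t) < 0
    linarith
  have hbd : β T ∈ bd r := mem_bd_of_mem_closure hcont
    (by rw [hlevel T ⟨hT0.le, le_rfl⟩]; linarith) hcl
  have hqV : β T ∈ V := subset_of_mem_nhdsSet hV hbd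
  refine ⟨hbd, ⟨hT0.le, hTt₀⟩, ?_⟩
  have hβz : ‖β T - z‖ ≤ 3 / 2 * T := by
    have h := norm_image_sub_le_of_norm_deriv_le_segment' (f := β)
      (f' := fun s => normalField r (β s)) (C := 3 / 2) (a := 0) (b := T) hβ
      (fun s _ => norm_normalField_le (hgrad _ (hβmem s))) T ⟨hT0.le, le_rfl⟩
    rwa [hβ0, sub_zero] at h
  have hφmem : ∀ t ∈ Icc 0 T, t ∈ Ico 0 t₀ := fun t ht => ⟨ht.1, ht.2.trans_lt hTt₀⟩
  have huniq := ODE_solution_unique_of_mem_Icc_right (v := fun _ x => -normalField r x)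
    (s := fun _ => Metric.closedBall z (δ / 2)) (K := K) (f := φ (β T))
    (g := fun t => β (T - t)) (a := 0) (b := T) (fun _ _ => hK.neg)
    (fun t ht => (hφ.ode _ hqV t (hφmem t ht)).continuousWithinAt.mono hφmem)
    (fun t ht => hφ.hasDerivWithinAt_Ici hqV (hφmem t (Ico_subset_Icc_self ht)))
    (fun t ht => by
      have h1 := hφ.norm_sub_le hU hqV (hφmem t (Ico_subset_Icc_self ht))
      rw [mem_closedBall_iff_norm, ← sub_add_sub_cancel _ (β T) z]
      refine (norm_add_le _ _).trans ?_
      linarith [ht.2])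
    (hβc.comp (continuous_const.sub continuous_id)).continuousOn
    (fun t ht => by
      have h1 : HasDerivWithinAt (fun s : ℝ => T - s) (-1) (Icc 0 T) t :=
        (hasDerivWithinAt_id t _).const_sub T
      have hmaps : MapsTo (fun s : ℝ => T - s) (Icc 0 T) (Icc 0 T) :=
        fun s hs => ⟨by linarith [hs.2], by linarith [hs.1]⟩
      have h2 := (hβ (T - t) (hmaps (Ico_subset_Icc_self ht))).scomp t h1 hmaps
      rw [neg_one_smul] at h2
      exact h2.mono_of_mem_nhdsWithin
        (mem_of_superset (Icc_mem_nhdsGE ht.2) (Icc_subset_Icc_left ht.1)))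
    (fun t _ => hβmem _) (by simp [hφ.init _ hqV])
  have := huniq ⟨hT0.le, le_rfl⟩
  simpa [hβ0] using this

end

end FlowTents

end

/-! ### Comparison of the tents -/

open FlowTents in
theorem theorem3p4 (n M : ℕ) (hn : 1 < n) (r : Cn n → ℝ) (hr : IsConvexFiniteType r M) :
    ∃ C₁ : ℝ, 1 < C₁ ∧
      ∀ (U V : Set (Cn n)) (t₀ : ℝ), IsAdmissibleNhd r U →
        ∃ τ₂ : ℝ, 0 < τ₂ ∧
          ∀ (φ : Cn n → ℝ → Cn n) (u : Cn n → ℝ → Fin n → Cn n),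
            IsNormalFlow r U V t₀ φ → IsExtremalChoice r u →
            (∀ ε : ℝ, 0 < ε → ε < τ₂ → ∀ ζ ∈ bd r,
              flowTentAt r u V t₀ φ ζ ε ⊆ projTentAt r u U ζ (C₁ * ε) ∧
              projTentAt r u U ζ ε ⊆ flowTentAt r u V t₀ φ ζ (C₁ * ε)) ∧
            (∀ (D : ℕ → Set (Set (Cn n))) (c : ℕ → Set (Cn n) → Cn n) (C δ ϵ : ℝ),
              IsDyadicGrid r u D c C δ ϵ →
              ∀ k, 1 ≤ k → ∀ Q ∈ D k, δ ^ k ≤ τ₂ / C →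
                projTent r U Q (δ ^ k) ⊆ flowTentAt r u V t₀ φ (c k Q) (C * C₁ * δ ^ k) ∧
                flowTent r V t₀ φ Q (δ ^ k) ⊆ projTentAt r u U (c k Q) (C * C₁ * δ ^ k)) := by
  obtain ⟨C₁, ε₁, hC₁, hε₁, hengulf⟩ := exists_polydisc_engulfing hr
  refine ⟨C₁, hC₁, fun U V t₀ hU => ?_⟩
  -- The threshold precedes φ in the quantifiers; when these conditions fail there is no flow and
  -- any threshold serves.
  by_cases hV : V ∈ 𝓝ˢ (bd r) ∧ V ⊆ U ∧ 0 < t₀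
  swap
  · exact ⟨1, one_pos, fun φ u hφ => absurd ⟨hφ.nhd, hφ.sub, hφ.time_pos⟩ hV⟩
  obtain ⟨τ, hτ, hflow⟩ := exists_flowProj hr hU hV.1 hV.2.1 hV.2.2
  refine ⟨min τ ε₁, by positivity, fun φ u hφ hu => ?_⟩
  have flow_to_proj : ∀ (S : Set (Cn n)) (s ε : ℝ), s ≤ ε → ε ≤ min τ ε₁ → ∀ ζ ∈ bd r,
      (∀ q ∈ S, ∃ ε', 0 < ε' ∧ ε' ≤ ε ∧ q ∈ polydisc r u ζ ε') →
      flowTent r V t₀ φ S s ⊆ projTentAt r u U ζ (C₁ * ε) := by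
    rintro S s ε hs hε ζ hζ hS z ⟨⟨hz, hzV⟩, ⟨q, hqS, hq⟩, hrz⟩
    have hzU : z ∈ dom r ∩ U := ⟨hz, hφ.sub hzV⟩
    obtain ⟨p, hp, -⟩ := hU.proj z hzU
    obtain ⟨ε', hε', hε'ε, hqP⟩ := hS q hqS
    have hdist : ‖p - q‖ ≤ 3 * ε := (norm_sub_proj_le hU hφ hp hq).trans (by linarith [hrz.1])
    refine ⟨hzU, ⟨p, ⟨hengulf u hu ζ hζ ε' ε hε' hε'ε (hε.trans (min_le_right _ _)) q hqP p hdist,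
      hp.1⟩, hp⟩, ?_, hrz.2⟩
    nlinarith [hrz.1]
  have proj_to_flow : ∀ (S : Set (Cn n)) (s ε : ℝ), s ≤ ε → ε ≤ min τ ε₁ → ∀ ζ ∈ bd r,
      (∀ p ∈ S, ∃ ε', 0 < ε' ∧ ε' ≤ ε ∧ p ∈ polydisc r u ζ ε') →
      projTent r U S s ⊆ flowTentAt r u V t₀ φ ζ (C₁ * ε) := by
    rintro S s ε hs hε ζ hζ hS z ⟨⟨hz, hzU⟩, ⟨p, hpS, hp⟩, hrz⟩
    obtain ⟨hzV, q, hq⟩ := hflow φ hφ z hz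
      (by linarith [hrz.1, hε.trans (min_le_left _ _)])
    obtain ⟨ε', hε', hε'ε, hpP⟩ := hS p hpS
    have hdist : ‖q - p‖ ≤ 3 * ε := by
      rw [norm_sub_rev]
      exact (norm_sub_proj_le hU hφ hp hq).trans (by linarith [hrz.1])
    refine ⟨⟨hz, hzV⟩, ⟨q, ⟨hengulf u hu ζ hζ ε' ε hε' hε'ε (hε.trans (min_le_right _ _)) p hpP q
      hdist, hq.1⟩, hq⟩, ?_, hrz.2⟩
    nlinarith [hrz.1]
  refine ⟨fun ε hε hετ ζ hζ => ⟨?_, ?_⟩, fun D c C δ ϵ hD k hk Q hQ hδ => ?_⟩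
  · exact flow_to_proj _ ε ε le_rfl hετ.le ζ hζ fun q hq => ⟨ε, hε, le_rfl, hq.1⟩
  · exact proj_to_flow _ ε ε le_rfl hετ.le ζ hζ fun q hq => ⟨ε, hε, le_rfl, hq.1⟩
  · have hC := hD.one_lt_C
    have hδk : 0 < δ ^ k := pow_pos hD.δ_pos k
    have hle : C * δ ^ k ≤ min τ ε₁ := by rwa [le_div_iff₀' (by linarith)] at hδ
    have hs : δ ^ k ≤ C * δ ^ k := by nlinarith
    -- The infimum defining `rho` yields only some scale ε' below C * δ ^ k, which is why engulfing
    -- allows ε' ≤ ε.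
    have hcover : ∀ q ∈ Q, ∃ ε', 0 < ε' ∧ ε' ≤ C * δ ^ k ∧ q ∈ polydisc r u (c k Q) ε' := by
      intro q hq
      have h := ((hD.sandwich k hk Q hQ).2 hq).2
      simp only [rho, iInf_lt_iff] at h
      obtain ⟨ε', ⟨hε', hq', -⟩, hlt⟩ := h
      exact ⟨ε', hε', (ENNReal.ofReal_lt_ofReal_iff (by positivity)).1 hlt |>.le, hq'⟩
    rw [show C * C₁ * δ ^ k = C₁ * (C * δ ^ k) by ring]
    exact ⟨proj_to_flow Q _ _ hs hle _ (hD.center_mem k hk Q hQ) hcover,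
      flow_to_proj Q _ _ hs hle _ (hD.center_mem k hk Q hQ) hcover⟩
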